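/- Fix integers $q,t\ge 0$ (in applications $q\ge 2$, $t\ge 1$). Let $V$ be a finite nonempty set of $n$ sites of local dimension $q$, and let $H_V=\big((\mathbb C^q)^{\otimes V}\big)^{\otimes t}\otimes\big((\mathbb C^q)^{\otimes V}\big)^{\otimes t}$. For a set $A\subseteq V$ of sites let $G_A$ be the averaged gate on $A$, i.e. the expectation of $(U\otimes 1_{V\setminus A})^{\otimes t}\otimes\overline{(U\otimes 1_{V\setminus A})}^{\otimes t}$, acting on $H_V$, for a Haar-random unitary $U$ on the sites in $A$. The subleading singular value (SSV) of an operator is its largest singular value different from $1$ (and $0$ if there is none). A layer is a family of pairwise disjoint two-site gates; its operator is the product of the corresponding $G_{\{a,b\}}$. It is complete if exactly one gate acts on each site. A cluster-merging graph on $V$ consists of a partition of $V$ into clusters (the nodes; the weight of a node is its number of sites) and a layer of two-site gates each of which joins two distinct clusters (the edges; several edges may join the same two nodes). Its SSV $\mathscr s$ is the SSV of $PQ$, where $Q=\prod_{C} G_C$ over the clusters $C$ and $P=\prod_{\{a,b\}}G_{\{a,b\}}$ over the edges. For even $m\ge 2$ let $s_{1D}(m)$ be the SSV of $P_2P_1$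 on the sites $0,\dots,m-1$, where $P_1$ is the layer of gates on the pairs $\{2j,\,2j+1 \bmod m\}$ and $P_2$ the layer of gates on the pairs $\{2j-1 \bmod m,\,2j \bmod m\}$ (the periodic 1D brickwork loop). Theorem. 1. For every cluster-merging graph on $n$ sites all of whose nodes have even weight and even degree, $$\mathscr s\le\max_{2\le m\le n,\ m\text{ even}} s_{1D}(m).$$ 2. Let $P_0,P_1,P_2,\dots$ be (the operators of) any complete layers on the $n$ sites, let $k\ge 1$, and let $Q$ be the orthogonal projector onto the unit eigenspace of $P_{k-1}\cdots P_0$. Then the SSV of $P_kQ$ (the layer-restricted subleading singular value of the layer $P_k$) satisfies the same bound. -/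

import Mathlib

open MeasureTheory

noncomputable section

/-- The unitary group of a finite-dimensional Hilbert space is compact. -/
instance unitaryGroup_compactSpace (ι : Type*) [Fintype ι] [DecidableEq ι] :
    CompactSpace (Matrix.unitaryGroup ι ℂ) := by
  refine isCompact_iff_compactSpace.mp
    (?_ : IsCompact ((Matrix.unitaryGroup ι ℂ : Submonoid (Matrix ι ι ℂ)) : Set (Matrix ι ι ℂ)))
  have hK : IsCompact {M : Matrix ι ι ℂ | ∀ i, i ∈ (Set.univ : Set ι) →
      M i ∈ {w : ι → ℂ | ∀ j, j ∈ (Set.univ : Set ι) → w j ∈ Metric.closedBall (0 : ℂ) 1}} :=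
    isCompact_univ_pi fun _ => isCompact_univ_pi fun _ => isCompact_closedBall 0 1
  refine hK.of_isClosed_subset ?_ ?_
  · have : ((Matrix.unitaryGroup ι ℂ : Submonoid (Matrix ι ι ℂ)) : Set (Matrix ι ι ℂ)) =
        {M | star M * M = 1} ∩ {M | M * star M = 1} := by
      ext M
      exact Iff.rfl
    rw [this]
    exact (isClosed_eq (continuous_star.mul continuous_id) continuous_const).inter
      (isClosed_eq (continuous_id.mul continuous_star) continuous_const)
  · intro M hM i _ j _
    simpa using entry_norm_bound_of_unitary hM i j

/-- The normalised Haar (probability) measure on the unitary group, with its Borel σ-algebra. -/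
def haarUnitary (ι : Type*) [Fintype ι] [DecidableEq ι] :
    @Measure (Matrix.unitaryGroup ι ℂ) (borel _) :=
  letI : MeasurableSpace (Matrix.unitaryGroup ι ℂ) := borel _
  haveI : BorelSpace (Matrix.unitaryGroup ι ℂ) := ⟨rfl⟩
  Measure.haarMeasure ⊤

section Operators

variable {V : Type*} [Fintype V] [DecidableEq V]

/-- The operator `U ⊗ 1` on all sites `V` (local dimension `q`), for an operator `U` on the
sites in `A`. -/
def onSites (q : ℕ) (A : Finset V) (U : Matrix (A → Fin q) (A → Fin q) ℂ) :
    Matrix (V → Fin q) (V → Fin q) ℂ :=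
  fun x y => if ∀ v, v ∉ A → x v = y v then U (fun v => x v) (fun v => y v) else 0

/-- Basis labels of `t` copies of the space with basis `ι` and `t` copies of its conjugate. -/
abbrev FoldedIndex (t : ℕ) (ι : Type*) : Type _ := (Fin t → ι) × (Fin t → ι)

/-- `U^{⊗t,t} = U^{⊗t} ⊗ (U^*)^{⊗t}`, where `U^*` is the entrywise complex conjugate. -/
def tensorFold (t : ℕ) {ι : Type*} (U : Matrix ι ι ℂ) :
    Matrix (FoldedIndex t ι) (FoldedIndex t ι) ℂ :=
  fun x y => (∏ k, U (x.1 k) (y.1 k)) * ∏ k, star (U (x.2 k) (y.2 k))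

/-- The Hilbert space on which the transfer matrix of a circuit on the sites `V` acts. -/
abbrev FoldedSpace (q t : ℕ) (V : Type*) [Fintype V] : Type _ :=
  EuclideanSpace ℂ (FoldedIndex t (V → Fin q))

/-- The averaged gate on the set of sites `A`: the expected value of `(U ⊗ 1)^{⊗t,t}` for a
Haar-random unitary `U` on the sites in `A`. -/
def avgGate (q t : ℕ) (A : Finset V) : FoldedSpace q t V →ₗ[ℂ] FoldedSpace q t V :=
  Matrix.toEuclideanLin fun x y =>
    @integral (Matrix.unitaryGroup (A → Fin q) ℂ) ℂ _ _ (borel _) (haarUnitary (A → Fin q))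
      fun U => tensorFold t (onSites q A U.1) x y

/-- The product of the averaged gates on a family of pairwise disjoint sets of sites. Gates on
disjoint sets of sites commute, so the order of the factors is immaterial. -/
def layerOp (q t : ℕ) (S : Finset (Finset V)) : Module.End ℂ (FoldedSpace q t V) :=
  (S.toList.map (avgGate q t)).prod

/-- The subleading singular value: the largest singular value different from `1` (and `0` if
there is none). -/
def subleadingSV {E : Type*} [NormedAddCommGroup E] [InnerProductSpace ℂ E]
    [FiniteDimensional ℂ E] (T : E →ₗ[ℂ] E) : ℝ :=
  sSup {s : ℝ | s ∈ Set.range T.singularValues ∧ s ≠ 1}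

end Operators

/-- A cluster-merging graph on the set of sites `V`. Its nodes are the parts (clusters) of a
partition of the sites, the weight of a node being its number of sites. Its edges are two-site
gates acting on pairwise disjoint pairs of sites, each joining two distinct clusters; several
edges may join the same two nodes. -/
structure ClusterMergingGraph (V : Type*) [Fintype V] [DecidableEq V] where
  nodes : Finpartition (Finset.univ : Finset V)
  edges : Finset (Finset V)
  card_edge : ∀ e ∈ edges, e.card = 2
  disjoint_edges : ∀ e ∈ edges, ∀ e' ∈ edges, e ≠ e' → Disjoint e e'
  joins_distinct : ∀ e ∈ edges, ∀ C ∈ nodes.parts, ¬ e ⊆ C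

namespace ClusterMergingGraph

variable {V : Type*} [Fintype V] [DecidableEq V]

/-- The number of edges with an endpoint in the cluster `C`. -/
def degree (G : ClusterMergingGraph V) (C : Finset V) : ℕ :=
  (G.edges.filter fun e => ¬ Disjoint e C).card

/-- The operator `P Q` of the graph: `Q` is the product over the nodes of the averaged gates on
the whole clusters, and `P` is the product over the edges of the averaged two-site gates. -/
def op (G : ClusterMergingGraph V) (q t : ℕ) : Module.End ℂ (FoldedSpace q t V) :=
  layerOp q t G.edges * layerOp q t G.nodes.parts

/-- The subleading singular value of the graph. -/
def ssv (G : ClusterMergingGraph V) (q t : ℕ) : ℝ := subleadingSV (G.op q t)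

end ClusterMergingGraph

/-- A complete layer: two-site gates such that exactly one gate acts on each site. -/
structure CompleteLayer (V : Type*) [Fintype V] [DecidableEq V] where
  gates : Finpartition (Finset.univ : Finset V)
  card_gate : ∀ e ∈ gates.parts, e.card = 2

section Layers

variable {V : Type*} [Fintype V] [DecidableEq V]

/-- The product `P_{k-1} ⋯ P_1 P_0` of the first `k` layers. -/
def layerProduct (q t : ℕ) (L : ℕ → CompleteLayer V) : ℕ → Module.End ℂ (FoldedSpace q t V)
  | 0 => 1
  | k + 1 => layerOp q t (L k).gates.parts * layerProduct q t L k

/-- The subleading singular value of `P_k Q`, where `Q` is the orthogonal projector onto the unit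
eigenspace of the product `P_{k-1} ⋯ P_0` of the layers below `P_k`. -/
def layerRestrictedSSV (q t : ℕ) (L : ℕ → CompleteLayer V) (k : ℕ) : ℝ :=
  subleadingSV (layerOp q t (L k).gates.parts *
    ((Module.End.eigenspace (layerProduct q t L k) 1).starProjection :
      FoldedSpace q t V →ₗ[ℂ] FoldedSpace q t V))

end Layers

/-- The sites `a mod m` and `b mod m`, among the sites `0, …, m - 1`. -/
def sitePair (m a b : ℕ) : Finset (Fin m) :=
  Finset.univ.filter fun i => i.val = a % m ∨ i.val = b % m

/-- The transfer matrix of the periodic 1D brickwork loop on `m` sites (`m` even): the first layer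
has gates on the sites `{2j, 2j+1 mod m}`, the second on `{2j-1 mod m, 2j mod m}`. -/
def brickworkOp (q t m : ℕ) : Module.End ℂ (FoldedSpace q t (Fin m)) :=
  layerOp q t ((Finset.Icc 1 (m / 2)).image fun j => sitePair m (2 * j - 1) (2 * j)) *
    layerOp q t ((Finset.Icc 1 (m / 2)).image fun j => sitePair m (2 * j) (2 * j + 1))

/-- `s_1D(m)`: the subleading singular value of the 1D brickwork loop on `m` sites. -/
def brickworkSSV (q t m : ℕ) : ℝ := subleadingSV (brickworkOp q t m)

/-- The maximum of `s_1D(m)` over the even numbers `2 ≤ m ≤ n`, a finite set of reals that is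
nonempty for `n ≥ 2`. -/
def maxBrickworkSSV (q t n : ℕ) : ℝ :=
  sSup (brickworkSSV q t '' {m | Even m ∧ 2 ≤ m ∧ m ≤ n})

end

/-! Invariant theory turns every averaged gate into the orthogonal projection onto a subspace
`invSub q t A`, so each operator in the theorem is a product `P_K P_L` of two projections. Its
subleading singular value is controlled by the distance from `P_K P_L` to the projection onto `K ⊓
L` (`FriedrichsBound`), and conversely bounds it. Such bounds can be moved between pairs of
subspaces: `L` may shrink as long as it keeps containing `K ⊓ L'` (`FriedrichsBound.mono_right`),
systems on disjoint sites combine without loss (`FriedrichsBound.inf`), and spectator sites do not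
matter (`FriedrichsBound.of_slices`).

The algebraic input is universality of overlapping gates. Infinitesimally, `invSub q t A` is the
commutant of the operators `∑ₖ Mₖ` with `M` acting on `A`. Operators on two overlapping sets of
sites generate, as a Lie algebra, all operators on the union, so invariance under both gates is
invariance under the gate on the union (`mem_invSub_union`). Hence two-site gates that connect a
cluster are as restrictive as the gate on the cluster.

The rest is combinatorics of matchings. Even weights and degrees allow the edges to be completed to
a perfect matching `e` by pairs inside clusters, which the cluster projection absorbs. A perfect
matching `f` inside the clusters can be chosen so that `e` and `f` together connect each cluster
(`exists_connecting_involution`). If `K`, `L_f`, `L` belong to `e`, `f` and the clusters, then `K ⊓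
L_f ≤ L ≤ L_f`, so a bound for `(K, L_f)` holds for `(K, L)`. The union of `e` and `f` is a disjoint
union of alternating cycles, and each of these is a 1D brickwork loop of even length at most `n`.
For a sequence of layers, the unit eigenspace of the layers below is the cluster subspace of the
connected components of their gates, so the same bound applies. -/

/-! ### Orthogonal projections, Friedrichs bounds and singular values -/

section Projections

variable {E : Type*} [NormedAddCommGroup E] [InnerProductSpace ℂ E] [FiniteDimensional ℂ E]

/-- The orthogonal projection onto `K`, as a linear endomorphism. -/
noncomputable def proj (K : Submodule ℂ E) : Module.End ℂ E := (K.starProjection : E →ₗ[ℂ] E)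

theorem proj_mem (K : Submodule ℂ E) (v : E) : proj K v ∈ K := K.starProjection_apply_mem v

theorem proj_eq_self_iff {K : Submodule ℂ E} {v : E} : proj K v = v ↔ v ∈ K :=
  Submodule.starProjection_eq_self_iff

theorem proj_eq_of_mem_of_inner {K : Submodule ℂ E} {u v : E} (hu : u ∈ K)
    (h : ∀ w ∈ K, inner ℂ w (v - u) = 0) : proj K v = u :=
  (Submodule.eq_starProjection_of_mem_orthogonal hu ((Submodule.mem_orthogonal _ _).2 h) :)

theorem inner_proj_left (K : Submodule ℂ E) (u v : E) :
    inner ℂ (proj K u) v = inner ℂ u (proj K v) :=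
  K.inner_starProjection_left_eq_right u v

theorem inner_sub_proj {K : Submodule ℂ E} {w : E} (hw : w ∈ K) (v : E) :
    inner ℂ w (v - proj K v) = 0 := by
  rw [inner_sub_right, ← inner_proj_left, proj_eq_self_iff.2 hw, sub_self]

theorem norm_proj_le (K : Submodule ℂ E) (v : E) : ‖proj K v‖ ≤ ‖v‖ :=
  K.norm_starProjection_apply_le v

theorem norm_proj_eq_iff {K : Submodule ℂ E} {v : E} : ‖proj K v‖ = ‖v‖ ↔ v ∈ K :=
  ((Submodule.mem_iff_norm_starProjection K v)).symm

theorem norm_sq_eq_proj (K : Submodule ℂ E) (v : E) :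
    ‖v‖ ^ 2 = ‖proj K v‖ ^ 2 + ‖v - proj K v‖ ^ 2 := by
  have h : inner ℂ (proj K v) (v - proj K v) = 0 := inner_sub_proj (proj_mem K v) v
  have := norm_add_sq_eq_norm_sq_add_norm_sq_of_inner_eq_zero (𝕜 := ℂ) _ _ h
  rw [add_sub_cancel] at this
  simpa [sq] using this

/-- An operator that preserves `K` together with its adjoint commutes with the projection. -/
theorem map_proj_of_invariant {K : Submodule ℂ E} {T T' : Module.End ℂ E}
    (hadj : ∀ u v, inner ℂ (T' u) v = inner ℂ u (T v)) (hT : ∀ w ∈ K, T w ∈ K)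
    (hT' : ∀ w ∈ K, T' w ∈ K) (v : E) : T (proj K v) = proj K (T v) := by
  refine (proj_eq_of_mem_of_inner (hT _ (proj_mem K v)) fun w hw => ?_).symm
  rw [← map_sub, ← hadj]
  exact inner_sub_proj (hT' w hw) v

theorem commute_proj_of_invariant {K L : Submodule ℂ E} (h : ∀ w ∈ L, proj K w ∈ L) :
    Commute (proj K) (proj L) :=
  LinearMap.ext fun v => map_proj_of_invariant (inner_proj_left K) h h v

theorem proj_mem_of_commute {K L : Submodule ℂ E} (h : Commute (proj K) (proj L)) {w : E}
    (hw : w ∈ L) : proj K w ∈ L := by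
  rw [← proj_eq_self_iff] at hw ⊢
  have := LinearMap.congr_fun h.eq w
  simp only [Module.End.mul_apply] at this
  rw [← this, hw]

theorem commute_proj_inf {K L M : Submodule ℂ E} (h₁ : Commute (proj K) (proj L))
    (h₂ : Commute (proj K) (proj M)) : Commute (proj K) (proj (L ⊓ M)) :=
  commute_proj_of_invariant fun _ hw =>
    ⟨proj_mem_of_commute h₁ hw.1, proj_mem_of_commute h₂ hw.2⟩

theorem commute_proj_iInf {ι : Sort*} {K : Submodule ℂ E} {L : ι → Submodule ℂ E}
    (h : ∀ i, Commute (proj K) (proj (L i))) : Commute (proj K) (proj (⨅ i, L i)) :=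
  commute_proj_of_invariant fun w hw => by
    rw [Submodule.mem_iInf] at hw ⊢
    exact fun i => proj_mem_of_commute (h i) (hw i)

theorem proj_inf {K L : Submodule ℂ E} (h : Commute (proj K) (proj L)) :
    proj (K ⊓ L) = proj K * proj L := by
  refine LinearMap.ext fun v => proj_eq_of_mem_of_inner ⟨proj_mem K _, ?_⟩ fun w hw => ?_
  · exact proj_mem_of_commute h (proj_mem L v)
  · rw [Module.End.mul_apply, inner_sub_right, ← inner_proj_left, ← inner_proj_left,
      proj_eq_self_iff.2 hw.1, proj_eq_self_iff.2 hw.2, sub_self]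

theorem proj_top : proj (⊤ : Submodule ℂ E) = 1 :=
  LinearMap.ext fun _ => proj_eq_self_iff.2 trivial

/-- The product of a list of pairwise commuting projections is the projection onto the
intersection of their ranges. -/
theorem list_prod_proj {ι : Type*} (K : ι → Submodule ℂ E) (l : List ι)
    (h : ∀ i ∈ l, ∀ j ∈ l, Commute (proj (K i)) (proj (K j))) :
    (l.map fun i => proj (K i)).prod = proj (⨅ i ∈ l, K i) := by
  induction l with
  | nil => simp [proj_top]
  | cons a l ih =>
    have hc : Commute (proj (K a)) (proj (⨅ i ∈ l, K i)) :=
      commute_proj_iInf fun i => commute_proj_iInf fun hi => h a (by simp) i (by simp [hi])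
    rw [List.map_cons, List.prod_cons, ih fun i hi j hj => h i (by simp [hi]) j (by simp [hj]),
      ← proj_inf hc]
    congr 1
    simp [iInf_or, iInf_inf_eq]

/-- The operator `P_K P_L` is `s`-close to the projection onto `K ⊓ L`. -/
def FriedrichsBound (K L : Submodule ℂ E) (s : ℝ) : Prop :=
  ∀ v, ‖proj K (proj L v) - proj (K ⊓ L) v‖ ≤ s * ‖v‖

theorem proj_proj_of_le {K L : Submodule ℂ E} (h : K ≤ L) (v : E) : proj K (proj L v) = proj K v := by
  refine (proj_eq_of_mem_of_inner (proj_mem K _) fun w hw => ?_).symm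
  rw [inner_sub_right, ← inner_proj_left, proj_eq_self_iff.2 hw, ← inner_proj_left,
    proj_eq_self_iff.2 (h hw), sub_self]

/-- Both pairs have the same intersection, and a vector of `L` already lies in `L'`, so it suffices
to apply the bound for `L'` to `P_L v`. -/
theorem FriedrichsBound.mono_right {K L L' : Submodule ℂ E} {s : ℝ} (hs : 0 ≤ s)
    (h : FriedrichsBound K L' s) (hL : L ≤ L') (hK : K ⊓ L' ≤ L) : FriedrichsBound K L s := by
  intro v
  have e : K ⊓ L = K ⊓ L' := le_antisymm (inf_le_inf_left K hL) (le_inf inf_le_left hK)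
  have h1 := h (proj L v)
  rw [proj_eq_self_iff.2 (hL (proj_mem L v)), proj_proj_of_le hK] at h1
  rw [e]
  exact h1.trans (mul_le_mul_of_nonneg_left (norm_proj_le L v) hs)

theorem FriedrichsBound.top {s : ℝ} (hs : 0 ≤ s) :
    FriedrichsBound (⊤ : Submodule ℂ E) ⊤ s := by
  intro v
  simpa [proj_top] using mul_nonneg hs (norm_nonneg v)

/-- The error of the product splits into two orthogonal pieces, one fed by `(1 - R₁) v` and one by
`R₁ v`. Pythagoras then gives the constant `s` itself rather than a sum of two errors. -/
theorem FriedrichsBound.inf {K₁ L₁ K₂ L₂ : Submodule ℂ E} {s : ℝ} (hs : 0 ≤ s)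
    (h₁ : FriedrichsBound K₁ L₁ s) (h₂ : FriedrichsBound K₂ L₂ s)
    (hKK : Commute (proj K₁) (proj K₂)) (hKL : Commute (proj K₁) (proj L₂))
    (hLK : Commute (proj L₁) (proj K₂)) (hLL : Commute (proj L₁) (proj L₂)) :
    FriedrichsBound (K₁ ⊓ K₂) (L₁ ⊓ L₂) s := by
  intro v
  set R₁ := proj (K₁ ⊓ L₁) with hR₁
  set R₂ := proj (K₂ ⊓ L₂) with hR₂
  have cK : Commute (proj K₂) R₁ := commute_proj_inf hKK.symm hLK.symm
  have cL : Commute (proj L₂) R₁ := commute_proj_inf hKL.symm hLL.symm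
  have cR : Commute R₁ R₂ := commute_proj_inf cK.symm cL.symm
  have eR : proj (K₁ ⊓ K₂ ⊓ (L₁ ⊓ L₂)) = R₁ * R₂ := by
    rw [inf_inf_inf_comm, proj_inf cR]
  have eKL : proj K₁ * proj K₂ * (proj L₁ * proj L₂) =
      proj K₁ * proj L₁ * (proj K₂ * proj L₂) := by
    rw [mul_assoc, ← mul_assoc (proj K₂), ← hLK.eq]; simp only [mul_assoc]
  -- With `Tᵢ = P_{Kᵢ} P_{Lᵢ}` this is `T₁T₂ - R₁R₂ = T₁T₂(1 - R₁) + R₁(T₂ - R₂)`; it uses `T₁R₁ =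
  -- R₁` and that `R₁` commutes with `T₂`.
  have eT : proj (K₁ ⊓ K₂) (proj (L₁ ⊓ L₂) v) - proj (K₁ ⊓ K₂ ⊓ (L₁ ⊓ L₂)) v =
      (proj K₁ (proj L₁ (proj K₂ (proj L₂ (v - R₁ v))))) +
        R₁ (proj K₂ (proj L₂ v) - R₂ v) := by
    have a1 : R₁ (proj K₂ (proj L₂ v)) = proj K₂ (proj L₂ (R₁ v)) := by
      have := LinearMap.congr_fun cK.eq (proj L₂ v)
      have h2 := LinearMap.congr_fun cL.eq v
      simp only [Module.End.mul_apply] at this h2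
      rw [← this, ← h2]
    have a2 : proj K₁ (proj L₁ (R₁ (proj K₂ (proj L₂ v)))) = R₁ (proj K₂ (proj L₂ v)) := by
      have hm := proj_mem (K₁ ⊓ L₁) (proj K₂ (proj L₂ v))
      rw [proj_eq_self_iff.2 (show R₁ (proj K₂ (proj L₂ v)) ∈ L₁ from hm.2),
        proj_eq_self_iff.2 (show R₁ (proj K₂ (proj L₂ v)) ∈ K₁ from hm.1)]
    have a3 := LinearMap.congr_fun eKL v
    have a4 : R₁ (proj K₂ (proj L₂ v)) = proj K₁ (proj L₁ (proj K₂ (proj L₂ (R₁ v)))) := by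
      rw [← a1, a2]
    simp only [Module.End.mul_apply] at a3
    rw [eR, proj_inf hKK, proj_inf hLL]
    simp only [Module.End.mul_apply, map_sub]
    rw [a3, a4]
    abel
  set w := proj K₂ (proj L₂ (v - R₁ v)) with hw
  have hRw : R₁ w = 0 := by
    have h1 := LinearMap.congr_fun cK.eq (proj L₂ (v - R₁ v))
    have h2 := LinearMap.congr_fun cL.eq (v - R₁ v)
    simp only [Module.End.mul_apply] at h1 h2
    rw [hw, ← h1, ← h2, map_sub, proj_eq_self_iff.2 (proj_mem (K₁ ⊓ L₁) v), sub_self, map_zero,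
      map_zero]
  have b1 : ‖proj K₁ (proj L₁ w)‖ ≤ s * ‖v - R₁ v‖ := by
    have := h₁ w
    rw [← hR₁, hRw, sub_zero] at this
    exact this.trans (mul_le_mul_of_nonneg_left
      ((norm_proj_le _ _).trans (norm_proj_le _ _)) hs)
  have b2 : ‖R₁ (proj K₂ (proj L₂ v) - R₂ v)‖ ≤ s * ‖R₁ v‖ := by
    have h1 := LinearMap.congr_fun cK.eq (proj L₂ v)
    have h2 := LinearMap.congr_fun cL.eq v
    have h3 := LinearMap.congr_fun cR.eq v
    simp only [Module.End.mul_apply] at h1 h2 h3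
    have := h₂ (R₁ v)
    rwa [h2, h1, ← hR₂, ← h3, ← map_sub] at this
  -- The range of `R₁` is fixed by `P_{K₁}` and `P_{L₁}`, so both can be moved off `w`, and `R₁ w =
  -- 0`.
  have horth : inner ℂ (proj K₁ (proj L₁ w)) (R₁ (proj K₂ (proj L₂ v) - R₂ v)) = 0 := by
    have hm := proj_mem (K₁ ⊓ L₁) (proj K₂ (proj L₂ v) - R₂ v)
    rw [inner_proj_left, proj_eq_self_iff.2 hm.1, inner_proj_left, proj_eq_self_iff.2 hm.2,
      ← inner_proj_left, ← hR₁, hRw, inner_zero_left]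
  have hpy := norm_add_sq_eq_norm_sq_add_norm_sq_of_inner_eq_zero (𝕜 := ℂ) _ _ horth
  rw [eT]
  refine le_of_sq_le_sq ?_ (by positivity)
  rw [sq, hpy, mul_pow, norm_sq_eq_proj (K₁ ⊓ L₁) v]
  have c1 := mul_self_le_mul_self (norm_nonneg _) b1
  have c2 := mul_self_le_mul_self (norm_nonneg _) b2
  rw [← hR₁]
  nlinarith

theorem subleadingSV_set_nonneg (T : E →ₗ[ℂ] E) :
    ∀ x ∈ {s : ℝ | s ∈ Set.range T.singularValues ∧ s ≠ 1}, 0 ≤ x := by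
  rintro _ ⟨⟨i, rfl⟩, -⟩
  exact T.singularValues_nonneg i

theorem subleadingSV_nonneg (T : E →ₗ[ℂ] E) : 0 ≤ subleadingSV T :=
  Real.sSup_nonneg (subleadingSV_set_nonneg T)

theorem singularValues_le_subleadingSV (T : E →ₗ[ℂ] E) {i : ℕ} (h : T.singularValues i ≠ 1) :
    T.singularValues i ≤ subleadingSV T :=
  le_csSup (T.singularValues.finite_range.subset fun _ hx => hx.1).bddAbove ⟨⟨i, rfl⟩, h⟩

theorem adjoint_comp_proj_mul (K L : Submodule ℂ E) :
    LinearMap.adjoint (proj K * proj L) ∘ₗ (proj K * proj L) = proj L * proj K * proj L := by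
  refine LinearMap.ext fun v => ext_inner_left ℂ fun u => ?_
  simp only [LinearMap.comp_apply, LinearMap.adjoint_inner_right, Module.End.mul_apply]
  rw [inner_proj_left, ← inner_proj_left L, proj_eq_self_iff.2 (proj_mem K _)]

/-- A right singular vector with singular value `σ ≠ 1` is orthogonal to `K ⊓ L`, since `T*T` is
self-adjoint and fixes `K ⊓ L`; on it the bound reads `σ ≤ s`. -/
theorem subleadingSV_le_of_friedrichsBound {K L : Submodule ℂ E} {s : ℝ} (hs : 0 ≤ s)
    (h : FriedrichsBound K L s) : subleadingSV (proj K * proj L) ≤ s := by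
  set T := proj K * proj L with hT
  refine Real.sSup_le ?_ hs
  rintro _ ⟨⟨i, rfl⟩, hi⟩
  by_cases hn : i < Module.finrank ℂ E
  swap
  -- Beyond the dimension the sequence of singular values is `0` by convention.
  · rw [T.singularValues_of_finrank_le (not_lt.1 hn)]; exact hs
  obtain ⟨b, hb⟩ := (T.hasEigenvalue_adjoint_comp_self_sq_singularValues hn).exists_hasEigenvector
  have hb1 := hb.apply_eq_smul
  have hnorm : ‖T b‖ ^ 2 = T.singularValues i ^ 2 * ‖b‖ ^ 2 := by
    have : inner ℂ (T b) (T b) = inner ℂ b ((LinearMap.adjoint T ∘ₗ T) b) := by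
      rw [LinearMap.comp_apply, LinearMap.adjoint_inner_right]
    rw [hb1, inner_smul_right, inner_self_eq_norm_sq_to_K, inner_self_eq_norm_sq_to_K] at this
    exact_mod_cast this
  have hR : proj (K ⊓ L) b = 0 := by
    refine proj_eq_of_mem_of_inner (zero_mem _) fun w hw => ?_
    rw [sub_zero]
    have h1 : inner ℂ w ((LinearMap.adjoint T ∘ₗ T) b) = inner ℂ w b := by
      rw [hT, adjoint_comp_proj_mul]
      simp only [Module.End.mul_apply]
      rw [← inner_proj_left, proj_eq_self_iff.2 hw.2, ← inner_proj_left, proj_eq_self_iff.2 hw.1,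
        ← inner_proj_left, proj_eq_self_iff.2 hw.2]
    rw [hb1, inner_smul_right] at h1
    have h2 : ((T.singularValues i : ℂ) ^ 2 - 1) * inner ℂ w b = 0 := by
      rw [sub_mul, one_mul, sub_eq_zero]; exact_mod_cast h1
    rcases mul_eq_zero.1 h2 with h3 | h3
    · exfalso
      have h4 : T.singularValues i ^ 2 = 1 := by
        rw [sub_eq_zero] at h3; exact_mod_cast h3
      exact hi ((pow_eq_one_iff_of_nonneg (T.singularValues_nonneg i) two_ne_zero).1 h4)
    · exact h3
  have h5 := h b
  rw [hR, sub_zero] at h5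
  have hbpos : 0 < ‖b‖ := norm_pos_iff.2 hb.2
  have h6 : ‖T b‖ = T.singularValues i * ‖b‖ := by
    rw [← mul_pow] at hnorm
    exact (sq_eq_sq₀ (norm_nonneg _) (mul_nonneg (T.singularValues_nonneg i) hbpos.le)).1 hnorm
  exact le_of_mul_le_mul_right (h6 ▸ h5) hbpos

/-- Expansion in an eigenbasis of `T*T`: the eigenvectors with singular value `1` lie in `K ⊓ L`, so
on the orthogonal complement of `K ⊓ L` only the other singular values contribute. -/
theorem friedrichsBound_subleadingSV (K L : Submodule ℂ E) :
    FriedrichsBound K L (subleadingSV (proj K * proj L)) := by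
  set T := proj K * proj L with hT
  set s := subleadingSV T with hsdef
  have hs : 0 ≤ s := subleadingSV_nonneg T
  have hsym := T.isSymmetric_adjoint_comp_self
  set b := hsym.eigenvectorBasis rfl with hb
  have key : ∀ u, (∀ w ∈ K ⊓ L, inner ℂ w u = 0) → ‖T u‖ ≤ s * ‖u‖ := by
    intro u hu
    refine le_of_sq_le_sq ?_ (by positivity)
    have h1 : ((‖T u‖ ^ 2 : ℝ) : ℂ) =
        ∑ i : Fin (Module.finrank ℂ E),
          ((T.singularValues i ^ 2 * ‖(inner ℂ (b i) u : ℂ)‖ ^ 2 : ℝ) : ℂ) := by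
      have : inner ℂ (T u) (T u) = inner ℂ u ((LinearMap.adjoint T ∘ₗ T) u) := by
        rw [LinearMap.comp_apply, LinearMap.adjoint_inner_right]
      rw [inner_self_eq_norm_sq_to_K, ← b.sum_inner_mul_inner] at this
      push_cast
      rw [show ((‖T u‖ : ℝ) : ℂ) ^ 2 = _ from this]
      refine Finset.sum_congr rfl fun i _ => ?_
      rw [← hsym (b i) u, hb, hsym.apply_eigenvectorBasis, inner_smul_left,
        ← T.sq_singularValues_fin rfl i, ← hb]
      have : (inner ℂ u (b i) : ℂ) * inner ℂ (b i) u = (‖(inner ℂ (b i) u : ℂ)‖ : ℂ) ^ 2 := by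
        rw [← inner_conj_symm, Complex.conj_mul']
      simp only [RCLike.ofReal_eq_complex_ofReal, Complex.conj_ofReal]
      rw [mul_left_comm, this]
      push_cast
      rfl
    have h2 : ‖T u‖ ^ 2 =
        ∑ i : Fin (Module.finrank ℂ E), T.singularValues i ^ 2 * ‖(inner ℂ (b i) u : ℂ)‖ ^ 2 := by
      exact_mod_cast h1
    rw [h2, mul_pow, ← b.sum_sq_norm_inner_right u, Finset.mul_sum]
    refine Finset.sum_le_sum fun i _ => ?_
    by_cases hi : T.singularValues i = 1
    · have hm : b i ∈ K ⊓ L := by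
        -- Being fixed by `T*T = P_L P_K P_L` puts the vector in `L`, and then `P_K` cannot shorten
        -- it.
        have h3 : (LinearMap.adjoint T ∘ₗ T) (b i) = b i := by
          rw [hb, hsym.apply_eigenvectorBasis, ← T.sq_singularValues_fin rfl i, hi]
          simp
        rw [hT, adjoint_comp_proj_mul] at h3
        simp only [Module.End.mul_apply] at h3
        have hL : b i ∈ L := h3 ▸ proj_mem L _
        rw [proj_eq_self_iff.2 hL] at h3
        refine ⟨norm_proj_eq_iff.1 (le_antisymm (norm_proj_le _ _) ?_), hL⟩
        conv_lhs => rw [← h3]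
        exact norm_proj_le _ _
      simp [hu _ hm]
    · gcongr
      · exact T.singularValues_nonneg i
      · exact singularValues_le_subleadingSV T hi
  intro v
  have h1 := key (v - proj (K ⊓ L) v) fun w hw => inner_sub_proj hw v
  have h2 : T (v - proj (K ⊓ L) v) = proj K (proj L v) - proj (K ⊓ L) v := by
    rw [map_sub, hT]
    simp only [Module.End.mul_apply]
    rw [proj_eq_self_iff.2 (proj_mem (K ⊓ L) v).2, proj_eq_self_iff.2 (proj_mem (K ⊓ L) v).1]
  rw [h2] at h1
  refine h1.trans (mul_le_mul_of_nonneg_left ?_ hs)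
  have := norm_sq_eq_proj (K ⊓ L) v
  exact le_of_sq_le_sq (by nlinarith [sq_nonneg ‖proj (K ⊓ L) v‖]) (norm_nonneg v)

end Projections

/-! ### Tensor powers and sums of single-factor actions -/

section TensorPowers

open Matrix Kronecker

variable {I κ : Type*} [Fintype I]

/-- The tensor product of a family of matrices. -/
def tensorMat (W : I → Matrix κ κ ℂ) : Matrix (I → κ) (I → κ) ℂ :=
  fun x y => ∏ i, W i (x i) (y i)

theorem tensorMat_one [DecidableEq κ] [DecidableEq (I → κ)] :
    tensorMat (1 : I → Matrix κ κ ℂ) = 1 := by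
  ext x y
  simp only [tensorMat, Pi.one_apply, Matrix.one_apply, Finset.prod_ite_zero, Finset.mem_univ,
    forall_const, Finset.prod_const_one, funext_iff]

theorem tensorMat_mul [DecidableEq I] [Fintype κ] (W W' : I → Matrix κ κ ℂ) :
    tensorMat (W * W') = tensorMat W * tensorMat W' := by
  ext x y
  simp only [tensorMat, Pi.mul_apply, Matrix.mul_apply, ← Finset.prod_mul_distrib]
  rw [Finset.prod_univ_sum]
  simp

theorem tensorMat_conjTranspose (W : I → Matrix κ κ ℂ) :
    (tensorMat W)ᴴ = tensorMat fun i => (W i)ᴴ := by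
  ext x y
  simp [tensorMat, Matrix.conjTranspose_apply]

/-- In a commutative algebra, a product lies in every subalgebra that contains the power sums. -/
theorem prod_mem_of_psum_mem {R : Type*} [CommRing R] [Algebra ℂ R] (S : Subalgebra ℂ R)
    (m : I → R) (h : ∀ j : ℕ, ∑ i, m i ^ j ∈ S) : ∏ i, m i ∈ S := by
  have key : ∀ k, MvPolynomial.aeval m (MvPolynomial.esymm I ℂ k) ∈ S := by
    intro k
    induction k using Nat.strong_induction_on with
    | _ k ih =>
      rcases Nat.eq_zero_or_pos k with rfl | hk
      · simp
      -- Newton's identity expresses `k e_k` through earlier elementary symmetric polynomials and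
      -- power sums; dividing by `k` is possible over `ℂ`.
      have h1 := congrArg (MvPolynomial.aeval m) (MvPolynomial.mul_esymm_eq_sum I ℂ k)
      have h2 : (k : R) * MvPolynomial.aeval m (MvPolynomial.esymm I ℂ k) ∈ S := by
        simp only [map_mul, map_natCast, map_pow, map_neg, map_one, map_sum] at h1
        rw [h1]
        refine S.mul_mem (S.pow_mem (S.neg_mem S.one_mem) _) (S.sum_mem fun a ha => ?_)
        refine S.mul_mem (S.mul_mem (S.pow_mem (S.neg_mem S.one_mem) _)
          (ih _ (Finset.mem_filter.1 ha).2)) ?_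
        simpa [MvPolynomial.psum] using h a.2
      have h3 := S.smul_mem h2 ((k : ℂ)⁻¹)
      rwa [← nsmul_eq_mul, ← Nat.cast_smul_eq_nsmul ℂ, smul_smul,
        inv_mul_cancel₀ (by exact_mod_cast hk.ne'), one_smul] at h3
  -- The elementary symmetric polynomial of top degree is the product.
  have := key (Fintype.card I)
  rw [MvPolynomial.esymm, ← Finset.card_univ, Finset.powersetCard_self] at this
  simpa using this

/-- Commuting elements generate a commutative subalgebra, and the commutative case applies there to
the preimage of `S`. -/
theorem list_prod_mem_of_psum_mem {R : Type*} [Ring R] [Algebra ℂ R] (S : Subalgebra ℂ R)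
    (m : I → R) (hm : ∀ i j, Commute (m i) (m j)) (h : ∀ j : ℕ, ∑ i, m i ^ j ∈ S) :
    (Finset.univ.toList.map m).prod ∈ S := by
  have hc : IsMulCommutative (Algebra.adjoin ℂ (Set.range m)) :=
    Algebra.isMulCommutative_adjoin ℂ (by rintro _ ⟨i, rfl⟩ _ ⟨j, rfl⟩; exact hm i j)
  let _ : CommRing (Algebra.adjoin ℂ (Set.range m)) :=
    { Subalgebra.toRing _ with mul_comm := hc.is_comm.comm }
  let m' : I → Algebra.adjoin ℂ (Set.range m) := fun i => ⟨m i, Algebra.subset_adjoin ⟨i, rfl⟩⟩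
  have := prod_mem_of_psum_mem (S.comap (Algebra.adjoin ℂ (Set.range m)).val) m' fun j => by
    rw [Subalgebra.mem_comap, map_sum]
    simpa [m'] using h j
  rw [Subalgebra.mem_comap, ← Finset.prod_map_toList, map_list_prod, List.map_map] at this
  exact this

variable [DecidableEq I]

theorem tensorMat_update_apply (W : I → Matrix κ κ ℂ) (i : I) (M : Matrix κ κ ℂ) (x y : I → κ) :
    tensorMat (Function.update W i M) x y =
      M (x i) (y i) * ∏ j ∈ Finset.univ.erase i, W j (x j) (y j) := by
  rw [tensorMat, ← Finset.mul_prod_erase _ _ (Finset.mem_univ i), Function.update_self]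
  congr 1
  refine Finset.prod_congr rfl fun j hj => ?_
  rw [Function.update_of_ne (Finset.ne_of_mem_erase hj)]

/-- The tensor product as a linear function of the factor at `i`. -/
def tensorMatAt (W : I → Matrix κ κ ℂ) (i : I) :
    Matrix κ κ ℂ →ₗ[ℂ] Matrix (I → κ) (I → κ) ℂ where
  toFun M := tensorMat (Function.update W i M)
  map_add' M N := by
    ext x y
    simp only [Matrix.add_apply, tensorMat_update_apply, add_mul]
  map_smul' c M := by
    ext x y
    simp only [Matrix.smul_apply, tensorMat_update_apply, smul_eq_mul, mul_assoc, RingHom.id_apply]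

theorem tensorMatAt_apply (W : I → Matrix κ κ ℂ) (i : I) (M : Matrix κ κ ℂ) :
    tensorMatAt W i M = tensorMat (Function.update W i M) := rfl

variable [DecidableEq κ]

/-- The matrix `M` acting on the factor `i`. -/
def leg (i : I) : Matrix κ κ ℂ →ₗ[ℂ] Matrix (I → κ) (I → κ) ℂ := tensorMatAt 1 i

theorem leg_apply (i : I) (M : Matrix κ κ ℂ) :
    leg i M = tensorMat (Pi.mulSingle i M) := rfl

/-- The sum of the actions of `M` on the single factors. -/
def legSum (I : Type*) [Fintype I] [DecidableEq I] :
    Matrix κ κ ℂ →ₗ[ℂ] Matrix (I → κ) (I → κ) ℂ := ∑ i, leg i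

theorem legSum_apply (M : Matrix κ κ ℂ) : legSum I M = ∑ i, leg i M := by
  simp [legSum]

variable [Fintype κ]

theorem leg_mul (i : I) (M N : Matrix κ κ ℂ) : leg i (M * N) = leg i M * leg i N := by
  rw [leg_apply, leg_apply, leg_apply, ← tensorMat_mul, Pi.mulSingle_mul]

theorem leg_pow (i : I) (M : Matrix κ κ ℂ) (n : ℕ) : leg i (M ^ n) = leg i M ^ n := by
  induction n with
  | zero => rw [pow_zero, pow_zero, leg_apply, Pi.mulSingle_one, tensorMat_one]
  | succ n ih => rw [pow_succ, leg_mul, ih, pow_succ]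

theorem leg_commute {i j : I} (h : i ≠ j) (M N : Matrix κ κ ℂ) : Commute (leg i M) (leg j N) := by
  have := Pi.mulSingle_commute (f := fun _ : I => Matrix κ κ ℂ) h M N
  rw [Commute, SemiconjBy, leg_apply, leg_apply, ← tensorMat_mul, ← tensorMat_mul, this.eq]

/-- Actions on different factors commute, so only the diagonal terms survive. As a result the
operators `M` whose `legSum` commutes with a fixed matrix form a Lie algebra. -/
theorem legSum_lie (M N : Matrix κ κ ℂ) : legSum I (M * N - N * M) =
    legSum I M * legSum I N - legSum I N * legSum I M := by
  rw [map_sub]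
  simp only [legSum_apply, Finset.sum_mul_sum]
  rw [Finset.sum_comm (f := fun i j => leg i N * leg j M), ← Finset.sum_sub_distrib,
    ← Finset.sum_sub_distrib]
  refine Finset.sum_congr rfl fun i _ => ?_
  rw [← Finset.sum_sub_distrib, leg_mul, leg_mul, Finset.sum_eq_single i]
  · intro j _ hj
    rw [(leg_commute hj.symm M N).eq, sub_self]
  · exact fun h => absurd (Finset.mem_univ i) h

theorem prod_leg (W : I → Matrix κ κ ℂ) (l : List I) (hl : l.Nodup) :
    (l.map fun i => leg i (W i)).prod = tensorMat fun i => if i ∈ l then W i else 1 := by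
  induction l with
  | nil =>
    simp only [List.map_nil, List.prod_nil, List.not_mem_nil, if_false]
    exact tensorMat_one.symm
  | cons a l ih =>
    rw [List.nodup_cons] at hl
    rw [List.map_cons, List.prod_cons, ih hl.2, leg_apply, ← tensorMat_mul]
    congr 1
    funext i
    rcases eq_or_ne i a with rfl | h
    · simp [hl.1]
    · simp [h]

/-- What commutes with the sums of single-factor actions of the powers of `M` commutes with the
tensor power of `M`. -/
theorem commute_tensorPower {X : Matrix (I → κ) (I → κ) ℂ} {M : Matrix κ κ ℂ}
    (h : ∀ j : ℕ, Commute (legSum I (M ^ j)) X) : Commute (tensorMat fun _ : I => M) X := by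
  have h1 := list_prod_mem_of_psum_mem (Subalgebra.centralizer ℂ {X}) (fun i : I => leg i M)
    (fun i j => ?_) fun j => ?_
  · rw [prod_leg (fun _ => M) _ (Finset.nodup_toList _)] at h1
    simp only [Finset.mem_toList, Finset.mem_univ, if_true, Subalgebra.mem_centralizer_iff,
      Set.mem_singleton_iff, forall_eq] at h1
    exact h1.symm
  · rcases eq_or_ne i j with rfl | hij
    · exact Commute.refl _
    · exact leg_commute hij M M
  · rw [Subalgebra.mem_centralizer_iff]
    rintro _ rfl
    have := h j
    simp only [legSum_apply, leg_pow] at this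
    exact this.symm.eq

end TensorPowers

/-! ### Local operators and the invariant subspace of a set of sites -/

section OnSites

open Matrix Kronecker

variable {V : Type*} [Fintype V] [DecidableEq V] {q : ℕ}

theorem onSites_eq_submatrix (A : Finset V) (U : Matrix (A → Fin q) (A → Fin q) ℂ) :
    onSites q A U = (U ⊗ₖ (1 : Matrix ({v // v ∉ A} → Fin q) ({v // v ∉ A} → Fin q) ℂ)).submatrix
      (Equiv.piEquivPiSubtypeProd (· ∈ A) fun _ => Fin q)
      (Equiv.piEquivPiSubtypeProd (· ∈ A) fun _ => Fin q) := by
  ext x y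
  simp only [onSites, Matrix.submatrix_apply, Matrix.kroneckerMap_apply, Matrix.one_apply,
    Equiv.piEquivPiSubtypeProd_apply, funext_iff, Subtype.forall, mul_ite, mul_one, mul_zero]

theorem onSites_mul (A : Finset V) (U U' : Matrix (A → Fin q) (A → Fin q) ℂ) :
    onSites q A (U * U') = onSites q A U * onSites q A U' := by
  rw [onSites_eq_submatrix, onSites_eq_submatrix, onSites_eq_submatrix,
    Matrix.submatrix_mul_equiv, ← Matrix.mul_kronecker_mul, one_mul]

theorem onSites_one (A : Finset V) : onSites q A 1 = 1 := by
  rw [onSites_eq_submatrix, Matrix.one_kronecker_one, Matrix.submatrix_one_equiv]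

theorem onSites_conjTranspose (A : Finset V) (U : Matrix (A → Fin q) (A → Fin q) ℂ) :
    onSites q A Uᴴ = (onSites q A U)ᴴ := by
  rw [onSites_eq_submatrix, onSites_eq_submatrix, Matrix.conjTranspose_submatrix,
    Matrix.conjTranspose_kronecker, Matrix.conjTranspose_one]

theorem onSites_pow (A : Finset V) (U : Matrix (A → Fin q) (A → Fin q) ℂ) (n : ℕ) :
    onSites q A (U ^ n) = onSites q A U ^ n := by
  induction n with
  | zero => rw [pow_zero, pow_zero, onSites_one]
  | succ n ih => rw [pow_succ, onSites_mul, ih, pow_succ]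

/-- `onSites` as a linear map. -/
def onSitesₗ (q : ℕ) (A : Finset V) :
    Matrix (A → Fin q) (A → Fin q) ℂ →ₗ[ℂ] Matrix (V → Fin q) (V → Fin q) ℂ where
  toFun := onSites q A
  map_add' U U' := by
    ext x y
    simp only [onSites, Matrix.add_apply]
    split_ifs <;> simp
  map_smul' c U := by
    ext x y
    simp only [onSites, Matrix.smul_apply, RingHom.id_apply]
    split_ifs <;> simp

theorem onSitesₗ_apply (A : Finset V) (U : Matrix (A → Fin q) (A → Fin q) ℂ) :
    onSitesₗ q A U = onSites q A U := rfl

theorem onSites_mem_unitaryGroup {A : Finset V} {U : Matrix (A → Fin q) (A → Fin q) ℂ}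
    (hU : U ∈ Matrix.unitaryGroup (A → Fin q) ℂ) :
    onSites q A U ∈ Matrix.unitaryGroup (V → Fin q) ℂ := by
  rw [Matrix.mem_unitaryGroup_iff, Matrix.star_eq_conjTranspose] at hU ⊢
  rw [← onSites_conjTranspose, ← onSites_mul, hU, onSites_one]

/-- The family of one-site matrices `W` is trivial off the set of sites `A`. -/
def SupportedOn (A : Finset V) (W : V → Matrix (Fin q) (Fin q) ℂ) : Prop := ∀ v, v ∉ A → W v = 1

theorem tensorMat_eq_onSites {A : Finset V} {W : V → Matrix (Fin q) (Fin q) ℂ}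
    (hW : SupportedOn A W) : tensorMat W = onSites q A (tensorMat fun v : A => W v) := by
  ext x y
  simp only [onSites, tensorMat]
  have h1 : ∏ v ∈ Aᶜ, W v (x v) (y v) = if ∀ v, v ∉ A → x v = y v then 1 else 0 := by
    rw [Finset.prod_congr rfl (g := fun v => if x v = y v then (1 : ℂ) else 0)
      fun v hv => by rw [hW v (Finset.mem_compl.1 hv), Matrix.one_apply], Finset.prod_ite_zero]
    simp
  rw [← Finset.prod_mul_prod_compl A, h1, ← Finset.prod_coe_sort A]
  split_ifs <;> simp

theorem tensorMat_single {I κ : Type*} [Fintype I] [DecidableEq κ] [DecidableEq (I → κ)]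
    (a b : I → κ) :
    tensorMat (fun i => Matrix.single (a i) (b i) (1 : ℂ)) = Matrix.single a b 1 := by
  ext x y
  simp only [tensorMat, Matrix.single_apply, Finset.prod_ite_zero, Finset.mem_univ, forall_const,
    Finset.prod_const_one, funext_iff, forall_and]

/-- A matrix unit on the sites of `A` is a tensor product of one-site matrix units. Linear
statements about operators on `A` thus reduce to product operators. -/
theorem onSites_mem_span (A : Finset V) (U : Matrix (A → Fin q) (A → Fin q) ℂ) :
    onSites q A U ∈ Submodule.span ℂ (tensorMat '' {W | SupportedOn A W}) := by
  rw [← onSitesₗ_apply, Matrix.matrix_eq_sum_single U]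
  simp only [map_sum]
  refine Submodule.sum_mem _ fun a _ => Submodule.sum_mem _ fun b _ => ?_
  rw [← mul_one (U a b), ← smul_eq_mul, ← Matrix.smul_single, map_smul]
  refine Submodule.smul_mem _ _ (Submodule.subset_span ?_)
  let W : V → Matrix (Fin q) (Fin q) ℂ := fun v =>
    if h : v ∈ A then Matrix.single (a ⟨v, h⟩) (b ⟨v, h⟩) 1 else 1
  have hW : SupportedOn A W := fun v hv => dif_neg hv
  refine ⟨W, hW, ?_⟩
  rw [tensorMat_eq_onSites hW, onSitesₗ_apply, ← tensorMat_single]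
  congr 2
  funext v
  simp [W]

theorem onSites_commute {A B : Finset V} (h : Disjoint A B)
    (U : Matrix (A → Fin q) (A → Fin q) ℂ) (U' : Matrix (B → Fin q) (B → Fin q) ℂ) :
    Commute (onSites q A U) (onSites q B U') := by
  have key : ∀ W W' : V → Matrix (Fin q) (Fin q) ℂ, SupportedOn A W → SupportedOn B W' →
      Commute (tensorMat W) (tensorMat W') := by
    intro W W' hW hW'
    rw [Commute, SemiconjBy, ← tensorMat_mul, ← tensorMat_mul]
    congr 1
    funext v
    by_cases hv : v ∈ A
    · simp [hW' v (Finset.disjoint_left.1 h hv)]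
    · simp [hW v hv]
  have h1 := onSites_mem_span A U
  have h2 := onSites_mem_span B U'
  generalize onSites q A U = M at h1 ⊢
  generalize onSites q B U' = M' at h2 ⊢
  induction h1 using Submodule.span_induction with
  | mem _ hx =>
    obtain ⟨W, hW, rfl⟩ := hx
    induction h2 using Submodule.span_induction with
    | mem _ hy => obtain ⟨W', hW', rfl⟩ := hy; exact key W W' hW hW'
    | zero => exact Commute.zero_right _
    | add _ _ _ _ h h' => exact h.add_right h'
    | smul c _ _ h => exact h.smul_right c
  | zero => exact Commute.zero_left _
  | add _ _ _ _ h h' => exact h.add_left h'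
  | smul c _ _ h => exact h.smul_left c

variable {t : ℕ}

/-- A vector of the folded space as an operator on `t` copies of the space. -/
def toOperator (v : FoldedSpace q t V) :
    Matrix (Fin t → V → Fin q) (Fin t → V → Fin q) ℂ := fun a b => v (a, b)

/-- The vectors that, as operators on `t` copies, commute with `∑ₖ Mₖ` for each operator `M` on
the sites in `A`. -/
def invSub (q t : ℕ) (A : Finset V) : Submodule ℂ (FoldedSpace q t V) where
  carrier := {v | ∀ W, SupportedOn A W → Commute (legSum (Fin t) (tensorMat W)) (toOperator v)}
  zero_mem' _ _ := Commute.zero_right _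
  add_mem' ha hb W hW := (ha W hW).add_right (hb W hW)
  smul_mem' c _ ha W hW := (ha W hW).smul_right c

theorem invSub_anti {A B : Finset V} (h : A ⊆ B) : invSub q t B ≤ invSub q t A :=
  fun _ hv W hW => hv W fun v hvB => hW v fun hvA => hvB (h hvA)

theorem mem_invSub_iff_onSites {A : Finset V} {v : FoldedSpace q t V} : v ∈ invSub q t A ↔
    ∀ M, Commute (legSum (Fin t) (onSites q A M)) (toOperator v) := by
  refine ⟨fun h M => ?_, fun h W hW => tensorMat_eq_onSites hW ▸ h _⟩
  have h1 := onSites_mem_span A M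
  generalize onSites q A M = N at h1 ⊢
  induction h1 using Submodule.span_induction with
  | mem _ hx => obtain ⟨W, hW, rfl⟩ := hx; exact h W hW
  | zero => rw [map_zero]; exact Commute.zero_left _
  | add _ _ _ _ h h' => rw [map_add]; exact h.add_left h'
  | smul c _ _ h => rw [map_smul]; exact h.smul_left c

/-- If the tensor powers along a differentiable path through `1` commute with `X`, so does the
sum of the single-factor actions of the velocity. -/
theorem legSum_commute_of_hasDerivAt {κ : Type*} [Fintype κ] [DecidableEq κ]
    {X : Matrix (Fin t → κ) (Fin t → κ) ℂ} {Y : ℝ → Matrix κ κ ℂ} {Y' : Matrix κ κ ℂ}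
    (h0 : Y 0 = 1) (hY : ∀ a b, HasDerivAt (fun s => Y s a b) (Y' a b) 0)
    (hc : ∀ s, Commute (tensorMat fun _ : Fin t => Y s) X) : Commute (legSum (Fin t) Y') X := by
  have hd : ∀ x y : Fin t → κ, HasDerivAt (fun s => tensorMat (fun _ : Fin t => Y s) x y)
      (legSum (Fin t) Y' x y) 0 := by
    intro x y
    have := HasDerivAt.fun_finsetProd (u := Finset.univ) (x := (0 : ℝ))
      (f := fun (k : Fin t) s => Y s (x k) (y k)) (f' := fun k => Y' (x k) (y k))
      fun k _ => hY (x k) (y k)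
    have e : legSum (Fin t) Y' x y =
        ∑ i, (∏ j ∈ Finset.univ.erase i, Y 0 (x j) (y j)) • Y' (x i) (y i) := ?_
    · rw [e]; exact this
    rw [legSum_apply, Matrix.sum_apply]
    refine Finset.sum_congr rfl fun k _ => ?_
    rw [leg_apply, Pi.mulSingle, tensorMat_update_apply, h0, smul_eq_mul, mul_comm]
    rfl
  ext x z
  have h1 : HasDerivAt (fun s => ((tensorMat fun _ : Fin t => Y s) * X) x z)
      ((legSum (Fin t) Y' * X) x z) 0 := by
    simp only [Matrix.mul_apply]
    exact HasDerivAt.fun_sum fun y _ => (hd x y).mul_const _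
  have h2 : HasDerivAt (fun s => (X * (tensorMat fun _ : Fin t => Y s)) x z)
      ((X * legSum (Fin t) Y') x z) 0 := by
    simp only [Matrix.mul_apply]
    exact HasDerivAt.fun_sum fun y _ => (hd y z).const_mul _
  simp only [(hc _).eq] at h1
  exact h1.unique h2

open scoped Matrix.Norms.L2Operator in
/-- A skew-Hermitian matrix is the velocity at `1` of a path of unitary matrices. -/
theorem exists_unitary_path {κ : Type*} [Fintype κ] [DecidableEq κ] {H : Matrix κ κ ℂ}
    (hH : Hᴴ = -H) : ∃ Y : ℝ → Matrix κ κ ℂ, (∀ s, Y s ∈ Matrix.unitaryGroup κ ℂ) ∧ Y 0 = 1 ∧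
      ∀ a b, HasDerivAt (fun s => Y s a b) (H a b) 0 := by
  let +nondep : NormedAlgebra ℚ (Matrix κ κ ℂ) := .restrictScalars ℚ ℂ _
  refine ⟨fun s => NormedSpace.exp (s • H), fun s => ?_, by simp, fun a b => ?_⟩
  · refine NormedSpace.exp_mem_unitary_of_mem_skewAdjoint ?_
    rw [skewAdjoint.mem_iff, Matrix.star_eq_conjTranspose, Matrix.conjTranspose_smul, hH]
    simp
  · have h := hasDerivAt_exp_smul_const (𝕂 := ℝ) H (0 : ℝ)
    rw [zero_smul, NormedSpace.exp_zero, one_mul] at h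
    exact (hasDerivAt_pi.1 (hasDerivAt_pi.1 h a)) b

/-- What commutes with all tensor powers of unitary operators on `A` lies in `invSub q t A`. -/
theorem mem_invSub_of_unitary {A : Finset V} {v : FoldedSpace q t V}
    (h : ∀ U ∈ Matrix.unitaryGroup (A → Fin q) ℂ,
      Commute (tensorMat fun _ : Fin t => onSites q A U) (toOperator v)) : v ∈ invSub q t A := by
  rw [mem_invSub_iff_onSites]
  have key : ∀ H : Matrix (A → Fin q) (A → Fin q) ℂ, Hᴴ = -H →
      Commute (legSum (Fin t) (onSites q A H)) (toOperator v) := by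
    intro H hH
    obtain ⟨Y, hYu, hY0, hYd⟩ := exists_unitary_path hH
    refine legSum_commute_of_hasDerivAt (Y := fun s => onSites q A (Y s)) ?_ (fun a b => ?_)
      fun s => h _ (hYu s)
    · rw [hY0, onSites_one]
    · simp only [onSites]
      split_ifs
      · exact hYd _ _
      · exact hasDerivAt_const _ _
  intro M
  -- Every matrix is a complex combination of two skew-Hermitian ones, and the condition is complex
  -- linear in `M`.
  have e : M = (2 : ℂ)⁻¹ • (M - Mᴴ) + (-(2 : ℂ)⁻¹ * Complex.I) • (Complex.I • (M + Mᴴ)) := by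
    rw [smul_smul, mul_assoc, Complex.I_mul_I]
    ext a b
    simp
    ring
  rw [e, ← onSitesₗ_apply, map_add, map_smul, map_smul, map_add, map_smul, map_smul]
  refine Commute.add_left (Commute.smul_left (key _ ?_) _) (Commute.smul_left (key _ ?_) _)
  · rw [Matrix.conjTranspose_sub, Matrix.conjTranspose_conjTranspose, neg_sub]
  · rw [Matrix.conjTranspose_smul, Matrix.conjTranspose_add, Matrix.conjTranspose_conjTranspose,
      Complex.star_def, Complex.conj_I, neg_smul, add_comm]

/-- The powers of `onSites q A M` are again operators on `A`, so Newton's identities apply; no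
logarithm is taken and `M` need not be unitary. -/
theorem commute_tensorPower_of_mem_invSub {A : Finset V} {v : FoldedSpace q t V}
    (h : v ∈ invSub q t A) (M : Matrix (A → Fin q) (A → Fin q) ℂ) :
    Commute (tensorMat fun _ : Fin t => onSites q A M) (toOperator v) := by
  rw [mem_invSub_iff_onSites] at h
  refine commute_tensorPower fun j => ?_
  rw [← onSites_pow]
  exact h _

theorem tensorFold_eq_kronecker {ι : Type*} (M : Matrix ι ι ℂ) : tensorFold t M =
    (tensorMat fun _ : Fin t => M) ⊗ₖ (tensorMat fun _ : Fin t => M).map star := by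
  ext x y
  simp [tensorFold, tensorMat, Matrix.kroneckerMap_apply]

theorem tensorFold_mul {ι : Type*} [Fintype ι] (M N : Matrix ι ι ℂ) :
    tensorFold t (M * N) = tensorFold t M * tensorFold t N := by
  have h : (tensorMat fun _ : Fin t => M * N) =
      (tensorMat fun _ : Fin t => M) * tensorMat fun _ : Fin t => N := tensorMat_mul _ _
  have h2 : ∀ A B : Matrix (Fin t → ι) (Fin t → ι) ℂ, (A * B).map star = A.map star * B.map star :=
    fun A B => Matrix.map_mul (f := starRingEnd ℂ)
  rw [tensorFold_eq_kronecker, tensorFold_eq_kronecker, tensorFold_eq_kronecker, h, h2,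
    Matrix.mul_kronecker_mul]

theorem tensorFold_conjTranspose {ι : Type*} (M : Matrix ι ι ℂ) :
    tensorFold t Mᴴ = (tensorFold t M)ᴴ := by
  ext x y
  simp [tensorFold, Matrix.conjTranspose_apply]

/-- The action of `M^{⊗t,t}` on the folded space. -/
noncomputable def foldedAction (t : ℕ) (M : Matrix (V → Fin q) (V → Fin q) ℂ) : Module.End ℂ (FoldedSpace q t V) :=
  Matrix.toEuclideanLin (tensorFold t M)

theorem foldedAction_apply (M : Matrix (V → Fin q) (V → Fin q) ℂ) (v : FoldedSpace q t V)
    (x : FoldedIndex t (V → Fin q)) : foldedAction t M v x = ∑ y, tensorFold t M x y * v y := rfl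

theorem foldedAction_mul (M N : Matrix (V → Fin q) (V → Fin q) ℂ) :
    foldedAction t (M * N) = foldedAction t M * foldedAction t N := by
  refine LinearMap.ext fun v => ?_
  simp [foldedAction, tensorFold_mul, Matrix.toLpLin_mul_same]

theorem inner_foldedAction (M : Matrix (V → Fin q) (V → Fin q) ℂ) (u v : FoldedSpace q t V) :
    inner ℂ (foldedAction t Mᴴ u) v = inner ℂ u (foldedAction t M v) := by
  rw [foldedAction, tensorFold_conjTranspose, Matrix.toEuclideanLin_conjTranspose_eq_adjoint,
    LinearMap.adjoint_inner_left]
  rfl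

theorem toOperator_foldedAction (M : Matrix (V → Fin q) (V → Fin q) ℂ) (v : FoldedSpace q t V) :
    toOperator (foldedAction t M v) =
      (tensorMat fun _ : Fin t => M) * toOperator v * (tensorMat fun _ : Fin t => M)ᴴ := by
  ext a b
  simp only [toOperator, foldedAction_apply, Fintype.sum_prod_type, Matrix.mul_apply,
    Matrix.conjTranspose_apply, Finset.sum_mul]
  rw [Finset.sum_comm]
  refine Finset.sum_congr rfl fun d _ => Finset.sum_congr rfl fun c _ => ?_
  simp only [tensorFold, tensorMat, star_prod]
  ring

omit [DecidableEq V] in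
theorem toOperator_injective : Function.Injective (toOperator : FoldedSpace q t V → _) := by
  intro u v h
  ext x
  exact congrFun (congrFun h x.1) x.2

theorem foldedAction_eq_self_iff {M : Matrix (V → Fin q) (V → Fin q) ℂ}
    (hM : M ∈ Matrix.unitaryGroup (V → Fin q) ℂ) (v : FoldedSpace q t V) :
    foldedAction t M v = v ↔ Commute (tensorMat fun _ : Fin t => M) (toOperator v) := by
  rw [Matrix.mem_unitaryGroup_iff', Matrix.star_eq_conjTranspose] at hM
  have h1 : (tensorMat fun _ : Fin t => M)ᴴ * (tensorMat fun _ : Fin t => M) = 1 := by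
    rw [tensorMat_conjTranspose, ← tensorMat_mul, ← tensorMat_one]
    congr 1
    funext i
    exact hM
  rw [← toOperator_injective.eq_iff, toOperator_foldedAction]
  constructor
  · intro h
    rw [Commute, SemiconjBy]
    conv_rhs => rw [← h]
    rw [Matrix.mul_assoc _ _ (tensorMat _), h1, Matrix.mul_one]
  · intro h
    rw [h.eq, Matrix.mul_assoc, mul_eq_one_comm.1 h1, Matrix.mul_one]

/-- Links the two descriptions of invariance: Haar averaging needs the group form, Lie-algebraic
universality the infinitesimal one. One direction is Newton's identities, the other differentiation
along unitary paths. -/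
theorem mem_invSub_iff_foldedAction {A : Finset V} {v : FoldedSpace q t V} : v ∈ invSub q t A ↔
    ∀ U ∈ Matrix.unitaryGroup (A → Fin q) ℂ, foldedAction t (onSites q A U) v = v := by
  refine ⟨fun h U hU => ?_, fun h => mem_invSub_of_unitary fun U hU => ?_⟩
  · rw [foldedAction_eq_self_iff (onSites_mem_unitaryGroup hU)]
    exact commute_tensorPower_of_mem_invSub h U
  · rw [← foldedAction_eq_self_iff (onSites_mem_unitaryGroup hU)]
    exact h U hU

end OnSites

/-! ### Haar measure on the unitary group -/

section Haar

variable {ι : Type*} [Fintype ι] [DecidableEq ι]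

theorem isProbabilityMeasure_haarUnitary :
    @IsProbabilityMeasure _ (borel _) (haarUnitary ι) := by
  let : MeasurableSpace (Matrix.unitaryGroup ι ℂ) := borel _
  have : BorelSpace (Matrix.unitaryGroup ι ℂ) := ⟨rfl⟩
  exact ⟨Measure.haarMeasure_self (K₀ := ⊤)⟩

theorem integrable_haarUnitary {f : Matrix.unitaryGroup ι ℂ → ℂ} (hf : Continuous f) :
    @Integrable ℂ _ _ _ (borel _) f (haarUnitary ι) := by
  let : MeasurableSpace (Matrix.unitaryGroup ι ℂ) := borel _
  have : BorelSpace (Matrix.unitaryGroup ι ℂ) := ⟨rfl⟩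
  have := isProbabilityMeasure_haarUnitary (ι := ι)
  exact hf.integrable_of_hasCompactSupport (HasCompactSupport.of_compactSpace f)

theorem integral_haarUnitary_mul_left (U₀ : Matrix.unitaryGroup ι ℂ)
    (f : Matrix.unitaryGroup ι ℂ → ℂ) :
    @integral _ ℂ _ _ (borel _) (haarUnitary ι) (fun U => f (U₀ * U)) =
      @integral _ ℂ _ _ (borel _) (haarUnitary ι) f := by
  let : MeasurableSpace (Matrix.unitaryGroup ι ℂ) := borel _
  have : BorelSpace (Matrix.unitaryGroup ι ℂ) := ⟨rfl⟩
  have : (haarUnitary ι).IsMulLeftInvariant := Measure.isMulLeftInvariant_haarMeasure ⊤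
  exact integral_mul_left_eq_self f U₀

end Haar

/-! ### Averaged gates and layers as projections -/

section AvgGate

variable {V : Type*} [Fintype V] [DecidableEq V] {q t : ℕ}

theorem continuous_tensorFold_onSites (A : Finset V) (x y : FoldedIndex t (V → Fin q)) :
    Continuous fun U : Matrix.unitaryGroup (A → Fin q) ℂ =>
      tensorFold t (onSites q A U.1) x y := by
  have h : ∀ a b : V → Fin q, Continuous fun U : Matrix.unitaryGroup (A → Fin q) ℂ =>
      onSites q A U.1 a b := by
    intro a b
    unfold onSites
    split_ifs
    · exact (continuous_subtype_val).matrix_elem _ _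
    · exact continuous_const
  unfold tensorFold
  exact (continuous_finsetProd _ fun k _ => h _ _).mul
    (continuous_finsetProd _ fun k _ => (h _ _).star)

theorem avgGate_apply (A : Finset V) (v : FoldedSpace q t V) (x : FoldedIndex t (V → Fin q)) :
    avgGate q t A v x = @integral (Matrix.unitaryGroup (A → Fin q) ℂ) ℂ _ _ (borel _)
      (haarUnitary (A → Fin q)) fun U => foldedAction t (onSites q A U.1) v x := by
  let : MeasurableSpace (Matrix.unitaryGroup (A → Fin q) ℂ) := borel _
  simp only [foldedAction_apply]
  rw [integral_finsetSum]
  · simp only [integral_mul_const]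
    rfl
  · exact fun y _ => (integrable_haarUnitary (continuous_tensorFold_onSites A x y)).mul_const _

theorem continuous_foldedAction_onSites (A : Finset V) (v : FoldedSpace q t V)
    (x : FoldedIndex t (V → Fin q)) :
    Continuous fun U : Matrix.unitaryGroup (A → Fin q) ℂ =>
      foldedAction t (onSites q A U.1) v x := by
  simp only [foldedAction_apply]
  exact continuous_finsetSum _ fun y _ =>
    (continuous_tensorFold_onSites A x y).mul continuous_const

/-- The averaged gate is the orthogonal projection onto the invariant subspace. -/
theorem avgGate_eq_proj (A : Finset V) : avgGate q t A = proj (invSub q t A) := by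
  let : MeasurableSpace (Matrix.unitaryGroup (A → Fin q) ℂ) := borel _
  have := isProbabilityMeasure_haarUnitary (ι := A → Fin q)
  refine LinearMap.ext fun v => (proj_eq_of_mem_of_inner ?_ fun w hw => ?_).symm
  -- The average is invariant: a unitary `U₀` applied to it is absorbed by left invariance of Haar
  -- measure.
  · rw [mem_invSub_iff_foldedAction]
    intro U₀ hU₀
    ext x
    rw [foldedAction_apply]
    simp only [avgGate_apply, ← integral_const_mul]
    rw [← integral_finsetSum _ fun y _ =>
      (integrable_haarUnitary (continuous_foldedAction_onSites A v y)).const_mul _,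
      ← integral_haarUnitary_mul_left ⟨U₀, hU₀⟩ fun U => foldedAction t (onSites q A U.1) v x]
    congr 1
    funext U
    rw [← foldedAction_apply, Submonoid.coe_mul, onSites_mul, foldedAction_mul]
    rfl
  · rw [inner_sub_right, sub_eq_zero]
    simp only [PiLp.inner_apply, RCLike.inner_apply, avgGate_apply, ← integral_mul_const]
    rw [← integral_finsetSum _ fun y _ =>
      (integrable_haarUnitary (continuous_foldedAction_onSites A v y)).mul_const _]
    -- The adjoint of the action of `U` fixes `w`, so the pairing with `w` is constant in `U` and
    -- the average leaves it unchanged.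
    have h : ∀ U : Matrix.unitaryGroup (A → Fin q) ℂ,
        ∑ x, foldedAction t (onSites q A U.1) v x * (starRingEnd ℂ) (w x) =
          ∑ x, v x * (starRingEnd ℂ) (w x) := by
      intro U
      have h1 := inner_foldedAction (onSites q A U.1) w v
      have h2 := mem_invSub_iff_foldedAction.1 hw (U.1.conjTranspose)
        (Unitary.star_mem U.2)
      rw [← onSites_conjTranspose, h2] at h1
      simpa only [PiLp.inner_apply, RCLike.inner_apply] using h1.symm
    simp only [h]
    simp

/-- Unitaries on `A` and their adjoints commute with those on `B`, so they preserve `invSub q t B`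
and commute with its projection, which therefore preserves `invSub q t A`. -/
theorem commute_proj_invSub {A B : Finset V} (h : Disjoint A B) :
    Commute (proj (invSub q t A)) (proj (invSub q t B)) := by
  have hB : ∀ U : Matrix (A → Fin q) (A → Fin q) ℂ, ∀ w ∈ invSub q t B,
      foldedAction t (onSites q A U) w ∈ invSub q t B := by
    intro U w hw
    rw [mem_invSub_iff_foldedAction] at hw ⊢
    intro U' hU'
    rw [← Module.End.mul_apply, ← foldedAction_mul, ← (onSites_commute h U U').eq,
      foldedAction_mul, Module.End.mul_apply, hw U' hU']
  refine (commute_proj_of_invariant fun w hw => ?_).symm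
  rw [mem_invSub_iff_foldedAction] at hw ⊢
  intro U hU
  rw [map_proj_of_invariant (inner_foldedAction _) (hB U), hw U hU]
  rw [← onSites_conjTranspose]
  exact hB _

/-- The layer of averaged gates is the projection onto the vectors invariant under each gate. -/
theorem layerOp_eq_proj {S : Finset (Finset V)}
    (h : ∀ e ∈ S, ∀ e' ∈ S, e ≠ e' → Disjoint e e') :
    layerOp q t S = proj (⨅ e ∈ S, invSub q t e) := by
  have := list_prod_proj (invSub q t : Finset V → _) S.toList fun e he e' he' => by
    rcases eq_or_ne e e' with rfl | hne
    · exact Commute.refl _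
    · exact commute_proj_invSub (h e (Finset.mem_toList.1 he) e' (Finset.mem_toList.1 he') hne)
  simp only [Finset.mem_toList] at this
  rw [← this, layerOp]
  congr 1
  exact List.map_congr_left fun e _ => avgGate_eq_proj e

end AvgGate

/-! ### Universality: overlapping gates generate the gate on the union -/

section Universality

open Matrix

/-- A linear map takes values in `S` if it does so on `1` and on all commutators. -/
theorem mem_of_one_of_commutator {κ E : Type*} [Fintype κ] [DecidableEq κ] [AddCommGroup E]
    [Module ℂ E] (S : Submodule ℂ E) (f : Matrix κ κ ℂ →ₗ[ℂ] E) (h1 : f 1 ∈ S)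
    (hc : ∀ M N, f (M * N - N * M) ∈ S) (M : Matrix κ κ ℂ) : f M ∈ S := by
  have hoff : ∀ i j : κ, i ≠ j → f (single i j 1) ∈ S := by
    intro i j hij
    have := hc (single i i 1) (single i j 1)
    rwa [single_mul_single_same, single_mul_single_of_ne _ _ _ _ hij.symm, sub_zero, mul_one] at this
  have hdiag : ∀ i : κ, f (single i i 1) ∈ S := by
    intro i
    have hdiff : ∀ j : κ, f (single i i 1 - single j j 1) ∈ S := by
      intro j
      have := hc (single i j 1) (single j i 1)
      rwa [single_mul_single_same, single_mul_single_same, mul_one] at this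
    -- Since `1` is the sum of the diagonal units, the argument is a nonzero multiple of `single i i
    -- 1`.
    have h2 : f (∑ j : κ, (single i i 1 - single j j 1) + 1) ∈ S := by
      rw [map_add, map_sum]
      exact S.add_mem (S.sum_mem fun j _ => hdiff j) h1
    have hone : (1 : Matrix κ κ ℂ) = ∑ j, single j j 1 := by
      rw [matrix_eq_sum_single (1 : Matrix κ κ ℂ)]
      refine Finset.sum_congr rfl fun j _ => ?_
      rw [Finset.sum_eq_single j] <;> simp +contextual [one_apply, eq_comm]
    rw [Finset.sum_sub_distrib, ← hone, sub_add_cancel, Finset.sum_const, Finset.card_univ,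
      ← Nat.cast_smul_eq_nsmul ℂ, map_smul] at h2
    have hq : (Fintype.card κ : ℂ) ≠ 0 := by
      have : Nonempty κ := ⟨i⟩
      exact_mod_cast Fintype.card_ne_zero
    rwa [S.smul_mem_iff hq] at h2
  rw [matrix_eq_sum_single M]
  simp only [map_sum]
  refine S.sum_mem fun i _ => S.sum_mem fun j _ => ?_
  rw [← mul_one (M i j), ← smul_eq_mul, ← smul_single, map_smul]
  refine S.smul_mem _ ?_
  rcases eq_or_ne i j with rfl | hij
  · exact hdiag i
  · exact hoff i j hij

variable {V : Type*} [Fintype V] [DecidableEq V] {q : ℕ}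
  {S : Submodule ℂ (Matrix (V → Fin q) (V → Fin q) ℂ)} {A B : Finset V} {c : V}
  {W : V → Matrix (Fin q) (Fin q) ℂ}

/-- The factors of `W` are shared out between `A` and `B` so that the two product operators overlap
nontrivially only at `c`; their commutator then has `MN - NM` there. -/
theorem tensorMat_commutator_mem_at (hS : ∀ M ∈ S, ∀ N ∈ S, M * N - N * M ∈ S)
    (hA : ∀ W, SupportedOn A W → tensorMat W ∈ S) (hB : ∀ W, SupportedOn B W → tensorMat W ∈ S)
    (hcA : c ∈ A) (hcB : c ∈ B) (hW : SupportedOn (A ∪ B) W) (M N : Matrix (Fin q) (Fin q) ℂ) :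
    tensorMat (Function.update W c (M * N - N * M)) ∈ S := by
  let α : V → Matrix (Fin q) (Fin q) ℂ := fun v => if v ∈ A then if v = c then M else W v else 1
  let β : V → Matrix (Fin q) (Fin q) ℂ := fun v => if v ∈ A then if v = c then N else 1 else W v
  have hα : SupportedOn A α := fun v hv => if_neg hv
  have hβ : SupportedOn B β := by
    intro v hv
    have : v ≠ c := fun h => hv (h ▸ hcB)
    by_cases hvA : v ∈ A
    · simp [β, hvA, this]
    · simp [β, hvA, hW v (by simp [hvA, hv])]
  have e1 : α * β = Function.update W c (M * N) := by
    funext v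
    rcases eq_or_ne v c with rfl | h
    · simp [α, β, hcA]
    · by_cases hvA : v ∈ A <;> simp [α, β, hvA, h]
  have e2 : β * α = Function.update W c (N * M) := by
    funext v
    rcases eq_or_ne v c with rfl | h
    · simp [α, β, hcA]
    · by_cases hvA : v ∈ A <;> simp [α, β, hvA, h]
  have := hS _ (hA α hα) _ (hB β hβ)
  rwa [← tensorMat_mul, ← tensorMat_mul, e1, e2, ← tensorMatAt_apply, ← tensorMatAt_apply,
    ← map_sub, tensorMatAt_apply] at this

/-- The commutator is moved from the shared site `c` to `a`. With `W c` expanded in matrix units,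
the off-diagonal units are themselves commutators at `c`; the diagonal ones require a further
commutator with an operator on `A`. -/
theorem tensorMat_commutator_mem_left (hS : ∀ M ∈ S, ∀ N ∈ S, M * N - N * M ∈ S)
    (hA : ∀ W, SupportedOn A W → tensorMat W ∈ S) (hB : ∀ W, SupportedOn B W → tensorMat W ∈ S)
    (hcA : c ∈ A) (hcB : c ∈ B) (hW : SupportedOn (A ∪ B) W) {a : V} (ha : a ∈ A)
    (M N : Matrix (Fin q) (Fin q) ℂ) : tensorMat (Function.update W a (M * N - N * M)) ∈ S := by
  rcases eq_or_ne a c with rfl | hac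
  · exact tensorMat_commutator_mem_at hS hA hB hcA hcB hW M N
  have hupd : ∀ K, SupportedOn (A ∪ B) (Function.update W a K) := by
    intro K v hv
    rw [Function.update_of_ne (by rintro rfl; simp [ha] at hv), hW v hv]
  have hat := fun K => tensorMat_commutator_mem_at hS hA hB hcA hcB (hupd K)
  have hoff : ∀ K (i j : Fin q), i ≠ j →
      tensorMat (Function.update (Function.update W a K) c (single i j 1)) ∈ S := by
    intro K i j hij
    have := hat K (single i i 1) (single i j 1)
    rwa [single_mul_single_same, single_mul_single_of_ne _ _ _ _ hij.symm, sub_zero, mul_one] at this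
  have hdiag : ∀ i : Fin q, tensorMat
      (Function.update (Function.update W a (M * N - N * M)) c (single i i 1)) ∈ S := by
    intro i
    by_cases hq : ∃ j, j ≠ i
    · obtain ⟨j, hji⟩ := hq
      -- In the slots `a, c`: `[M ⊗ Eᵢⱼ, N ⊗ Eⱼᵢ] = MN ⊗ Eᵢᵢ - NM ⊗ Eⱼⱼ`. Adding `NM ⊗ (Eⱼⱼ - Eᵢᵢ)`,
      -- a commutator at `c`, leaves `(MN - NM) ⊗ Eᵢᵢ`.
      let γ : V → Matrix (Fin q) (Fin q) ℂ :=
        Function.update (Function.update 1 a N) c (single j i 1)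
      have hγ : SupportedOn A γ := by
        intro v hv
        have h1 : v ≠ c := fun h => hv (h ▸ hcA)
        have h2 : v ≠ a := fun h => hv (h ▸ ha)
        simp [γ, h1, h2]
      have e1 : Function.update (Function.update W a M) c (single i j 1) * γ =
          Function.update (Function.update W a (M * N)) c (single i i 1) := by
        funext v
        rcases eq_or_ne v c with rfl | h
        · simp [γ]
        · rcases eq_or_ne v a with rfl | h' <;> simp [γ, *]
      have e2 : γ * Function.update (Function.update W a M) c (single i j 1) =
          Function.update (Function.update W a (N * M)) c (single j j 1) := by
        funext v
        rcases eq_or_ne v c with rfl | h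
        · simp [γ]
        · rcases eq_or_ne v a with rfl | h' <;> simp [γ, *]
      have h1 := hS _ (hoff M i j hji.symm) _ (hA γ hγ)
      rw [← tensorMat_mul, ← tensorMat_mul, e1, e2] at h1
      have h2 := hat (N * M) (single j i 1) (single i j 1)
      rw [single_mul_single_same, single_mul_single_same, mul_one, ← tensorMatAt_apply, map_sub,
        tensorMatAt_apply, tensorMatAt_apply] at h2
      have h3 := S.add_mem h1 h2
      rw [sub_add_sub_cancel] at h3
      rwa [Function.update_comm hac, ← tensorMatAt_apply, map_sub, tensorMatAt_apply,
        tensorMatAt_apply, Function.update_comm hac.symm, Function.update_comm hac.symm]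
    -- Without a second basis label the matrices are scalars and the commutator vanishes.
    · have hsub : Subsingleton (Fin q) := ⟨fun x y => by
        push Not at hq
        rw [hq x, hq y]⟩
      have h0 : M * N - N * M = 0 := by
        rw [sub_eq_zero]
        ext x y
        rw [Subsingleton.elim x i, Subsingleton.elim y i, mul_apply, mul_apply]
        refine Finset.sum_congr rfl fun z _ => ?_
        rw [Subsingleton.elim z i, mul_comm]
      rw [h0, Function.update_comm hac, ← tensorMatAt_apply, map_zero]
      exact S.zero_mem
  have hWc : Function.update W a (M * N - N * M) =
      Function.update (Function.update W a (M * N - N * M)) c (W c) := by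
    funext v
    rcases eq_or_ne v c with rfl | h
    · simp [hac.symm]
    · simp [h]
  rw [hWc, ← tensorMatAt_apply, matrix_eq_sum_single (W c)]
  simp only [map_sum]
  refine S.sum_mem fun i _ => S.sum_mem fun j _ => ?_
  rw [show single i j (W c i j) = W c i j • single i j 1 by
    rw [smul_single, smul_eq_mul, mul_one], map_smul]
  refine S.smul_mem _ ?_
  rcases eq_or_ne i j with rfl | hij
  · exact hdiag i
  · exact hoff _ i j hij

/-- The operators on `A` and on `B` generate, as a Lie algebra, the operators on `A ∪ B` if `A` and
`B` meet. -/
theorem tensorMat_mem_of_union (hS : ∀ M ∈ S, ∀ N ∈ S, M * N - N * M ∈ S)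
    (hA : ∀ W, SupportedOn A W → tensorMat W ∈ S) (hB : ∀ W, SupportedOn B W → tensorMat W ∈ S)
    (hcA : c ∈ A) (hcB : c ∈ B) (hW : SupportedOn (A ∪ B) W) : tensorMat W ∈ S := by
  have key : ∀ D : Finset V, D ⊆ A ∪ B → ∀ W, SupportedOn D W → tensorMat W ∈ S := by
    intro D
    induction D using Finset.induction_on with
    | empty => exact fun _ W hW => hA W fun v _ => hW v (Finset.notMem_empty v)
    | insert a D _ ih =>
      intro hD W hW
      rw [Finset.insert_subset_iff] at hD
      rw [← Function.update_eq_self a W, ← tensorMatAt_apply]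
      -- The slot at `a` is spanned by `1`, which shrinks the support to `D`, and by commutators.
      refine mem_of_one_of_commutator S _ ?_ (fun M N => ?_) _
      · refine ih hD.2 _ fun v hv => ?_
        rcases eq_or_ne v a with rfl | h
        · exact Function.update_self ..
        · rw [Function.update_of_ne h, hW v (by simp [h, hv])]
      · have hW' : SupportedOn (A ∪ B) W := fun v hv =>
          hW v fun h => hv (Finset.insert_subset hD.1 hD.2 h)
        rcases Finset.mem_union.1 hD.1 with h | h
        · exact tensorMat_commutator_mem_left hS hA hB hcA hcB hW' h M N
        · exact tensorMat_commutator_mem_left hS hB hA hcB hcA (Finset.union_comm A B ▸ hW') h M N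
  exact key _ (Finset.Subset.refl _) W hW

variable {t : ℕ}

/-- By `legSum_lie`, the operators whose `legSum` commutes with `toOperator v` are closed under
commutators, so containing those on `A` and on `B` they contain those on `A ∪ B`. -/
theorem mem_invSub_union {v : FoldedSpace q t V} (hA : v ∈ invSub q t A) (hB : v ∈ invSub q t B)
    (hcA : c ∈ A) (hcB : c ∈ B) : v ∈ invSub q t (A ∪ B) := by
  intro W hW
  let S : Submodule ℂ (Matrix (V → Fin q) (V → Fin q) ℂ) :=
    { carrier := {M | Commute (legSum (Fin t) M) (toOperator v)}
      zero_mem' := by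
        rw [Set.mem_ofPred_eq, map_zero]
        exact Commute.zero_left _
      add_mem' := fun {M N} hM hN => by
        rw [Set.mem_ofPred_eq, map_add]
        exact Commute.add_left hM hN
      smul_mem' := fun c M hM => by
        rw [Set.mem_ofPred_eq, map_smul]
        exact Commute.smul_left hM c }
  refine tensorMat_mem_of_union (S := S) (fun M hM N hN => ?_) hA hB hcA hcB hW
  change Commute _ _
  rw [legSum_lie]
  exact (Commute.mul_left hM hN).sub_left (Commute.mul_left hN hM)

/-- A vector invariant under the sets of sites of a family is invariant under each set of sites
that is connected by the family. -/
theorem mem_invSub_of_connected {v : FoldedSpace q t V} {r : V → V → Prop}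
    (hr : ∀ x y, r x y → ∃ e, x ∈ e ∧ y ∈ e ∧ v ∈ invSub q t e) (hrefl : ∀ x, ∃ y, r x y)
    {C : Finset V} (hC : ∀ x ∈ C, ∀ y ∈ C, Relation.EqvGen r x y) (hne : C.Nonempty) :
    v ∈ invSub q t C := by
  have h1 : ∀ x y, Relation.EqvGen r x y → ∃ e, x ∈ e ∧ y ∈ e ∧ v ∈ invSub q t e := by
    intro x y h
    induction h with
    | rel x y h => exact hr x y h
    | refl x =>
      obtain ⟨y, hy⟩ := hrefl x
      obtain ⟨e, hx, -, he⟩ := hr x y hy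
      exact ⟨e, hx, hx, he⟩
    | symm x y _ ih =>
      obtain ⟨e, hx, hy, he⟩ := ih
      exact ⟨e, hy, hx, he⟩
    | trans x y z _ _ ih ih' =>
      obtain ⟨e, hx, hy, he⟩ := ih
      obtain ⟨e', hy', hz, he'⟩ := ih'
      exact ⟨e ∪ e', Finset.mem_union_left _ hx, Finset.mem_union_right _ hz,
        mem_invSub_union he he' hy hy'⟩
  obtain ⟨x, hx⟩ := hne
  have h2 : ∀ D : Finset V, D ⊆ C → ∃ e, x ∈ e ∧ D ⊆ e ∧ v ∈ invSub q t e := by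
    intro D
    induction D using Finset.induction_on with
    | empty =>
      obtain ⟨e, hxe, -, he⟩ := h1 x x (Relation.EqvGen.refl x)
      exact fun _ => ⟨e, hxe, Finset.empty_subset _, he⟩
    | insert y D _ ih =>
      intro hD
      rw [Finset.insert_subset_iff] at hD
      obtain ⟨e, hxe, hDe, he⟩ := ih hD.2
      obtain ⟨e', hxe', hye', he'⟩ := h1 x y (hC x hx y hD.1)
      exact ⟨e' ∪ e, Finset.mem_union_right _ hxe, Finset.insert_subset
        (Finset.mem_union_left _ hye') (hDe.trans Finset.subset_union_right),
        mem_invSub_union he' he hxe' hxe⟩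
  obtain ⟨e, -, hCe, he⟩ := h2 C (Finset.Subset.refl C)
  exact invSub_anti hCe he

end Universality

/-! ### Friedrichs bounds in orthogonal direct sums of copies -/

section AbstractSlices

variable {E F Z : Type*} [NormedAddCommGroup E] [InnerProductSpace ℂ E] [FiniteDimensional ℂ E]
  [NormedAddCommGroup F] [InnerProductSpace ℂ F] [FiniteDimensional ℂ F] [Fintype Z]
  {S : Z → E →ₗ[ℂ] F}

/-- The maps `S z` identify `E` isometrically with a sum of copies of `F`, in which `K'` is `K` in
every copy; the projection therefore acts copy by copy. -/
theorem slice_proj (hS : ∀ u v, inner ℂ u v = ∑ z, inner ℂ (S z u) (S z v))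
    (hsurj : ∀ f : Z → F, ∃ u, ∀ z, S z u = f z) {K : Submodule ℂ F} {K' : Submodule ℂ E}
    (hK : ∀ v, v ∈ K' ↔ ∀ z, S z v ∈ K) (v : E) (z : Z) :
    S z (proj K' v) = proj K (S z v) := by
  obtain ⟨u, hu⟩ := hsurj fun z => proj K (S z v)
  have : proj K' v = u := by
    refine proj_eq_of_mem_of_inner ((hK u).2 fun z => hu z ▸ proj_mem K _) fun w hw => ?_
    rw [hS]
    refine Finset.sum_eq_zero fun z _ => ?_
    rw [map_sub, hu]
    exact inner_sub_proj ((hK w).1 hw z) _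
  rw [this, hu]

theorem FriedrichsBound.of_slices (hS : ∀ u v, inner ℂ u v = ∑ z, inner ℂ (S z u) (S z v))
    (hsurj : ∀ f : Z → F, ∃ u, ∀ z, S z u = f z) {K L : Submodule ℂ F} {K' L' : Submodule ℂ E}
    (hK : ∀ v, v ∈ K' ↔ ∀ z, S z v ∈ K) (hL : ∀ v, v ∈ L' ↔ ∀ z, S z v ∈ L) {s : ℝ} (hs : 0 ≤ s)
    (h : FriedrichsBound K L s) : FriedrichsBound K' L' s := by
  have hnorm : ∀ u, ‖u‖ ^ 2 = ∑ z, ‖S z u‖ ^ 2 := by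
    intro u
    have := hS u u
    simp only [inner_self_eq_norm_sq_to_K] at this
    exact_mod_cast this
  have hKL : ∀ v, v ∈ K' ⊓ L' ↔ ∀ z, S z v ∈ K ⊓ L := by
    intro v
    simp only [Submodule.mem_inf, hK, hL, forall_and]
  intro v
  refine le_of_sq_le_sq ?_ (by positivity)
  rw [hnorm, mul_pow, hnorm v, Finset.mul_sum]
  refine Finset.sum_le_sum fun z _ => ?_
  rw [map_sub, slice_proj hS hsurj hK, slice_proj hS hsurj hL, slice_proj hS hsurj hKL, ← mul_pow]
  exact pow_le_pow_left₀ (norm_nonneg _) (h _) 2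

end AbstractSlices

/-! ### Removing spectator sites -/

section Slices

open Matrix

/-- In the coordinates `g` the matrix `D` is `N ⊗ 1`, so multiplication by it acts on each block of
`X` separately. -/
theorem commute_iff_blocks {m n p : Type*} [Fintype m] [Fintype n] [Fintype p] [DecidableEq p]
    (g : m × p ≃ n) {D X : Matrix n n ℂ} {N : Matrix m m ℂ}
    (hD : ∀ a z a' z', D (g (a, z)) (g (a', z')) = N a a' * if z = z' then 1 else 0) :
    Commute D X ↔ ∀ z z', Commute N (Matrix.of fun a b => X (g (a, z)) (g (b, z'))) := by
  have h1 : ∀ a z b z', (D * X) (g (a, z)) (g (b, z')) =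
      (N * Matrix.of fun a b => X (g (a, z)) (g (b, z'))) a b := by
    intro a z b z'
    rw [mul_apply, ← g.sum_comp, Fintype.sum_prod_type, mul_apply]
    refine Finset.sum_congr rfl fun c _ => ?_
    simp [hD]
  have h2 : ∀ a z b z', (X * D) (g (a, z)) (g (b, z')) =
      ((Matrix.of fun a b => X (g (a, z)) (g (b, z'))) * N) a b := by
    intro a z b z'
    rw [mul_apply, ← g.sum_comp, Fintype.sum_prod_type, mul_apply]
    refine Finset.sum_congr rfl fun c _ => ?_
    simp [hD]
  constructor
  · intro h z z'
    ext a b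
    rw [← h1, ← h2, h.eq]
  · intro h
    ext x y
    obtain ⟨⟨a, z⟩, rfl⟩ := g.surjective x
    obtain ⟨⟨b, z'⟩, rfl⟩ := g.surjective y
    rw [h1, h2, (h z z').eq]

variable {V W : Type*} [Fintype V] [DecidableEq V] [Fintype W] {q t : ℕ}

/-- Configurations of the sites in the image of `φ` and of the other sites, glued together. -/
noncomputable def glue (q : ℕ) (φ : W ↪ V) : (W → Fin q) × ({v // v ∉ Set.range φ} → Fin q) ≃ (V → Fin q) where
  toFun x v := if h : ∃ w, φ w = v then x.1 h.choose else x.2 ⟨v, h⟩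
  invFun y := (fun w => y (φ w), fun v => y v)
  left_inv x := by
    ext v
    · have h : ∃ w, φ w = φ v := ⟨v, rfl⟩
      simp only [dif_pos h]
      rw [φ.injective h.choose_spec]
    · exact congrArg Fin.val (dif_neg v.2)
  right_inv y := by
    funext v
    by_cases h : ∃ w, φ w = v
    · simp only [dif_pos h, h.choose_spec]
    · simp only [dif_neg h]

omit [Fintype V] in
theorem glue_apply (φ : W ↪ V) (x : (W → Fin q) × ({v // v ∉ Set.range φ} → Fin q)) (w : W) :
    glue q φ x (φ w) = x.1 w :=
  congrFun (congrArg Prod.fst ((glue q φ).left_inv x)) w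

omit [Fintype V] in
theorem glue_apply' (φ : W ↪ V) (x : (W → Fin q) × ({v // v ∉ Set.range φ} → Fin q))
    (v : {v // v ∉ Set.range φ}) : glue q φ x v = x.2 v :=
  congrFun (congrArg Prod.snd ((glue q φ).left_inv x)) v

theorem tensorMat_glue (φ : W ↪ V) {M : V → Matrix (Fin q) (Fin q) ℂ}
    (hM : ∀ v, v ∉ Set.range φ → M v = 1) (a : W → Fin q) (z : {v // v ∉ Set.range φ} → Fin q)
    (a' : W → Fin q) (z' : {v // v ∉ Set.range φ} → Fin q) :
    tensorMat M (glue q φ (a, z)) (glue q φ (a', z')) =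
      tensorMat (fun w => M (φ w)) a a' * if z = z' then 1 else 0 := by
  simp only [tensorMat]
  rw [← Finset.prod_mul_prod_compl (Finset.univ.map φ), Finset.prod_map]
  simp only [glue_apply]
  congr 1
  have e : ∀ v, v ∈ (Finset.univ.map φ)ᶜ ↔ v ∉ Set.range φ := by simp
  rw [Finset.prod_subtype (F := inferInstance) _ e, Finset.prod_congr rfl
    (g := fun v => if z v = z' v then (1 : ℂ) else 0) fun v _ => by
      rw [hM v v.2, glue_apply', glue_apply', Matrix.one_apply], Finset.prod_ite_zero]
  simp [funext_iff]

/-- `t`-fold version of `glue`. -/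
noncomputable def glueCopies (q t : ℕ) (φ : W ↪ V) :
    (Fin t → W → Fin q) × (Fin t → {v // v ∉ Set.range φ} → Fin q) ≃ (Fin t → V → Fin q) :=
  (Equiv.arrowProdEquivProdArrow (Fin t) _ _).symm.trans ((Equiv.refl _).arrowCongr (glue q φ))

omit [Fintype V] in
theorem glueCopies_apply (φ : W ↪ V)
    (x : (Fin t → W → Fin q) × (Fin t → {v // v ∉ Set.range φ} → Fin q)) (k : Fin t) :
    glueCopies q t φ x k = glue q φ (x.1 k, x.2 k) := rfl

theorem legSum_glue (φ : W ↪ V) {M : Matrix (V → Fin q) (V → Fin q) ℂ}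
    {N : Matrix (W → Fin q) (W → Fin q) ℂ}
    (hM : ∀ a z a' z', M (glue q φ (a, z)) (glue q φ (a', z')) = N a a' * if z = z' then 1 else 0)
    (a : Fin t → W → Fin q) (z : Fin t → {v // v ∉ Set.range φ} → Fin q)
    (a' : Fin t → W → Fin q) (z' : Fin t → {v // v ∉ Set.range φ} → Fin q) :
    legSum (Fin t) M (glueCopies q t φ (a, z)) (glueCopies q t φ (a', z')) =
      legSum (Fin t) N a a' * if z = z' then 1 else 0 := by
  rw [legSum_apply, legSum_apply, Matrix.sum_apply, Matrix.sum_apply, Finset.sum_mul]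
  refine Finset.sum_congr rfl fun k _ => ?_
  have hone : ∀ b y b' y', (1 : Matrix (V → Fin q) (V → Fin q) ℂ) (glue q φ (b, y))
      (glue q φ (b', y')) = (1 : Matrix (W → Fin q) (W → Fin q) ℂ) b b' *
        if y = y' then 1 else 0 := by
    intro b y b' y'
    simp only [one_apply, (glue q φ).injective.eq_iff, Prod.mk.injEq]
    split_ifs <;> simp_all
  have h2 : (if z = z' then (1 : ℂ) else 0) = ∏ j, if z j = z' j then 1 else 0 := by
    rw [Finset.prod_ite_zero]
    simp [funext_iff]
  rw [h2, leg_apply, leg_apply, tensorMat, tensorMat, ← Finset.prod_mul_distrib]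
  refine Finset.prod_congr rfl fun j _ => ?_
  rw [glueCopies_apply, glueCopies_apply]
  rcases eq_or_ne j k with rfl | hj
  · rw [Pi.mulSingle_eq_same, Pi.mulSingle_eq_same, hM]
  · rw [Pi.mulSingle_eq_of_ne hj, Pi.mulSingle_eq_of_ne hj, hone]

/-- Configurations of the `t + t` copies of the sites outside the image of `φ`. -/
abbrev SliceIndex (q t : ℕ) (φ : W ↪ V) : Type _ :=
  FoldedIndex t ({v // v ∉ Set.range φ} → Fin q)

/-- The restriction of a vector of the folded space to a fixed configuration of the sites outside
the image of `φ`. -/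
noncomputable def slice (φ : W ↪ V) (z : SliceIndex q t φ) : FoldedSpace q t V →ₗ[ℂ] FoldedSpace q t W where
  toFun v := WithLp.toLp 2 fun x => v (glueCopies q t φ (x.1, z.1), glueCopies q t φ (x.2, z.2))
  map_add' u v := by ext x; rfl
  map_smul' c v := by ext x; rfl

theorem slice_apply (φ : W ↪ V) (z : SliceIndex q t φ) (v : FoldedSpace q t V)
    (x : FoldedIndex t (W → Fin q)) :
    slice φ z v x = v (glueCopies q t φ (x.1, z.1), glueCopies q t φ (x.2, z.2)) := rfl

/-- The indices of the folded space, split into those on the image of `φ` and the others. -/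
noncomputable def sliceEquiv (q t : ℕ) (φ : W ↪ V) :
    FoldedIndex t (W → Fin q) × SliceIndex q t φ ≃ FoldedIndex t (V → Fin q) :=
  (Equiv.prodProdProdComm _ _ _ _).trans ((glueCopies q t φ).prodCongr (glueCopies q t φ))

theorem inner_eq_sum_slice [DecidableEq W] (φ : W ↪ V) (u v : FoldedSpace q t V) :
    inner ℂ u v = ∑ z, inner ℂ (slice φ z u) (slice φ z v) := by
  simp only [PiLp.inner_apply, slice_apply]
  rw [← (sliceEquiv q t φ).sum_comp, Fintype.sum_prod_type, Finset.sum_comm]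
  rfl

theorem exists_slice_eq (φ : W ↪ V) (f : SliceIndex q t φ → FoldedSpace q t W) :
    ∃ u : FoldedSpace q t V, ∀ z, slice φ z u = f z := by
  refine ⟨WithLp.toLp 2 fun i =>
    f ((sliceEquiv q t φ).symm i).2 ((sliceEquiv q t φ).symm i).1, fun z => ?_⟩
  ext x
  have h : (sliceEquiv q t φ).symm
      (glueCopies q t φ (x.1, z.1), glueCopies q t φ (x.2, z.2)) = (x, z) :=
    (sliceEquiv q t φ).symm_apply_apply (x, z)
  rw [slice_apply]
  simp only [h]

/-- Operators on the image of `φ` have the form `N ⊗ 1` with respect to the other sites, and the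
blocks of `toOperator v` are the operators of its slices. -/
theorem mem_invSub_map_iff [DecidableEq W] (φ : W ↪ V) {A : Finset W} {v : FoldedSpace q t V} :
    v ∈ invSub q t (A.map φ) ↔ ∀ z, slice φ z v ∈ invSub q t A := by
  have key : ∀ M : V → Matrix (Fin q) (Fin q) ℂ, SupportedOn (A.map φ) M →
      (Commute (legSum (Fin t) (tensorMat M)) (toOperator v) ↔
        ∀ z, Commute (legSum (Fin t) (tensorMat fun w => M (φ w))) (toOperator (slice φ z v))) := by
    intro M hM
    rw [commute_iff_blocks (glueCopies q t φ)
      (legSum_glue φ (tensorMat_glue φ fun v hv => hM v fun h => hv (by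
        obtain ⟨w, -, rfl⟩ := Finset.mem_map.1 h
        exact ⟨w, rfl⟩)))]
    exact ⟨fun h z => h z.1 z.2, fun h z z' => h (z, z')⟩
  constructor
  · intro h z M hM
    let M' : V → Matrix (Fin q) (Fin q) ℂ := Function.extend φ M 1
    have hM' : ∀ w, M' (φ w) = M w := fun w => φ.injective.extend_apply _ _ _
    have hs : SupportedOn (A.map φ) M' := by
      intro v hv
      by_cases hv' : ∃ w, φ w = v
      · obtain ⟨w, rfl⟩ := hv'
        rw [hM', hM w fun h => hv (Finset.mem_map_of_mem φ h)]
      · exact Function.extend_apply' _ _ _ hv'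
    have := (key M' hs).1 (h M' hs) z
    simpa only [hM'] using this
  · intro h M hM
    exact (key M hM).2 fun z => h z _ fun w hw => hM _ fun h' => hw (by simpa using h')

end Slices

/-! ### Perfect matchings, alternating cycles and connectivity -/

section Matchings

open Relation

variable {V : Type*}

theorem exists_involution_of_even [DecidableEq V] {C : Finset V} (h : Even C.card) :
    ∃ f : V → V, ∀ x ∈ C, f x ∈ C ∧ f x ≠ x ∧ f (f x) = x := by
  obtain ⟨k, hk⟩ := h
  obtain ⟨g⟩ : Nonempty (C ≃ Fin k × Bool) :=
    ⟨Fintype.equivOfCardEq (by simp [hk, mul_two])⟩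
  refine ⟨fun x => if hx : x ∈ C then g.symm ((g ⟨x, hx⟩).1, !(g ⟨x, hx⟩).2) else x,
    fun x hx => ?_⟩
  simp only [dif_pos hx, Subtype.coe_eta, Equiv.apply_symm_apply, Bool.not_not, Prod.mk.eta,
    Equiv.symm_apply_apply]
  refine ⟨Subtype.coe_prop _, fun h => ?_, dif_pos (Subtype.coe_prop _)⟩
  have h1 := congrArg g (Subtype.ext (a2 := ⟨x, hx⟩) h)
  rw [Equiv.apply_symm_apply] at h1
  simpa using congrArg Prod.snd h1

theorem even_card_of_involution {C : Finset V} {f : V → V}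
    (h : ∀ x ∈ C, f x ∈ C ∧ f x ≠ x ∧ f (f x) = x) : Even C.card := by
  have : ∑ _x ∈ C, (1 : ZMod 2) = 0 :=
    Finset.sum_involution (fun x _ => f x) (fun _ _ => by decide) (fun x hx _ => (h x hx).2.1)
      (fun x hx => (h x hx).1) fun x hx => (h x hx).2.2
  rw [Finset.sum_const, nsmul_one, ZMod.natCast_eq_zero_iff] at this
  exact even_iff_two_dvd.2 this

variable [Fintype V]

/-- Each component of the union of two perfect matchings is an alternating cycle. -/
theorem exists_alternating_cycle {e f : V → V} (he : Function.Involutive e)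
    (hf : Function.Involutive f) (he' : ∀ x, e x ≠ x) (hf' : ∀ x, f x ≠ x) (x₀ : V) :
    ∃ (l : ℕ) (x : ℕ → V), 0 < l ∧ x 0 = x₀ ∧ (∀ i, x (i + 2 * l) = x i) ∧
      (∀ j, f (x (2 * j)) = x (2 * j + 1)) ∧ (∀ j, e (x (2 * j + 1)) = x (2 * j + 2)) ∧
      Set.InjOn x (Set.Iio (2 * l)) := by
  -- The cycle interleaves the `g`-orbit of `x₀` with its image under `f`; `f` conjugates `g` to its
  -- inverse.
  let g : Equiv.Perm V := hf.toPerm.trans he.toPerm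
  have hg : ∀ v, g v = e (f v) := fun v => rfl
  have hfg : ∀ n : ℤ, ∀ v, f ((g ^ n) v) = (g ^ (-n)) (f v) := by
    have h1 : hf.toPerm * g * hf.toPerm⁻¹ = g⁻¹ := by
      rw [mul_inv_eq_iff_eq_mul, eq_inv_mul_iff_mul_eq]
      ext v
      simp only [Equiv.Perm.mul_apply, Function.Involutive.coe_toPerm, hg]
      rw [hf (e (f v)), he]
    intro n v
    have h2 : hf.toPerm * g ^ n * hf.toPerm⁻¹ = g ^ (-n) := by
      rw [← conj_zpow, h1, inv_zpow']
    have := congrFun (congrArg DFunLike.coe (mul_inv_eq_iff_eq_mul.1 h2)) v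
    simpa using this
  -- The orbit and its `f`-image are disjoint: `f x₀ = g^(2k) x₀` would make `g^k x₀` a fixed point
  -- of `f`, and `f x₀ = g^(2k+1) x₀` would make `f (g^k x₀)` a fixed point of `e`.
  have hne : ∀ i j : ℤ, f ((g ^ i) x₀) ≠ (g ^ j) x₀ := by
    intro i j h
    have h1 : f x₀ = (g ^ (i + j)) x₀ := by
      rw [hfg] at h
      rw [zpow_add, Equiv.Perm.mul_apply, ← h, ← Equiv.Perm.mul_apply, ← zpow_add]
      simp
    rcases Int.even_or_odd' (i + j) with ⟨k, hk | hk⟩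
    · refine hf' ((g ^ k) x₀) ?_
      rw [hfg, h1, hk, ← Equiv.Perm.mul_apply, ← zpow_add]
      congr 2
      ring
    · refine he' (f ((g ^ k) x₀)) ?_
      rw [← hg, hfg, h1, hk, ← Equiv.Perm.mul_apply, ← Equiv.Perm.mul_apply, ← zpow_add,
        ← zpow_one_add]
      congr 2
      ring
  have hper : x₀ ∈ Function.periodicPts g :=
    Function.Injective.mem_periodicPts g.injective x₀
  refine ⟨Function.minimalPeriod g x₀,
    fun i => if Even i then g^[i / 2] x₀ else f (g^[i / 2] x₀),
    Function.minimalPeriod_pos_of_mem_periodicPts hper, by simp, fun i => ?_, fun j => ?_,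
    fun j => ?_, ?_⟩
  · have h1 : (i + 2 * Function.minimalPeriod g x₀) / 2 = i / 2 + Function.minimalPeriod g x₀ := by
      omega
    simp only [h1, Function.iterate_add_apply, Function.iterate_minimalPeriod]
    simp [Nat.even_add]
  · have h1 : (2 * j + 1) / 2 = j := by omega
    simp [h1]
  · have h1 : (2 * j + 1) / 2 = j := by omega
    have h2 : (2 * j + 2) / 2 = j + 1 := by omega
    have h3 : Even (2 * j + 2) := ⟨j + 1, by ring⟩
    simp only [h1, h2, if_pos h3, Nat.not_even_bit1, if_false, Function.iterate_succ_apply', hg]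
  · have hit : ∀ n : ℕ, g^[n] x₀ = (g ^ (n : ℤ)) x₀ := by
      intro n
      rw [zpow_natCast, Equiv.Perm.iterate_eq_pow]
    intro i hi j hj hij
    rw [Set.mem_Iio] at hi hj
    have hinj : g^[i / 2] x₀ = g^[j / 2] x₀ → i / 2 = j / 2 := fun h =>
      Function.iterate_injOn_Iio_minimalPeriod (Set.mem_Iio.2 (by omega))
        (Set.mem_Iio.2 (by omega)) h
    by_cases h1 : Even i <;> by_cases h2 : Even j <;> simp only [h1, h2, if_true, if_false] at hij
    · have := hinj hij
      rw [Nat.even_iff] at h1 h2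
      omega
    · rw [hit, hit] at hij
      exact absurd hij.symm (hne _ _)
    · rw [hit, hit] at hij
      exact absurd hij (hne _ _)
    · have := hinj (hf.injective hij)
      rw [Nat.not_even_iff] at h1 h2
      omega

variable [DecidableEq V]

/-- The graph of two matchings, given as involutions. -/
def MatchRel (e f : V → V) (x y : V) : Prop := y = e x ∨ y = f x

/-- Cutting the edge at `a` and another edge in a different component of a union of two perfect
matchings leaves the ends of the first edge connected. -/
theorem eqvGen_cut {e f : V → V} (he : Function.Involutive e) (hf : Function.Involutive f)
    (he' : ∀ x, e x ≠ x) (hf' : ∀ x, f x ≠ x) {a c : V} (hac : ¬ EqvGen (MatchRel e f) a c) :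
    EqvGen (fun x y => y = e x ∨ y = f x ∧ x ≠ a ∧ x ≠ f a ∧ x ≠ c ∧ x ≠ f c) a (f a) := by
  classical
  set r := fun x y => y = e x ∨ y = f x ∧ x ≠ a ∧ x ≠ f a ∧ x ≠ c ∧ x ≠ f c with hr
  by_contra hb
  have hle : ∀ x y, EqvGen r x y → EqvGen (MatchRel e f) x y := fun x y h =>
    EqvGen.mono (fun _ _ h' => Or.imp_right And.left h') _ _ h
  have hfc : ¬ EqvGen (MatchRel e f) a (f c) := fun h =>
    hac (h.trans _ _ _ (EqvGen.symm _ _ (EqvGen.rel c (f c) (Or.inr rfl))))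
  -- Parity: the component `K` of `a` after the cut is paired up by `e`. If it missed `f a`, then
  -- `f` would pair up `K` without `a`, and both cardinalities would be even.
  set K : Finset V := Finset.univ.filter fun v => EqvGen r a v with hK
  have hmem : ∀ v, v ∈ K ↔ EqvGen r a v := fun v => by simp [hK]
  have h1 : Even K.card := even_card_of_involution (f := e) fun x hx =>
    ⟨(hmem _).2 (((hmem x).1 hx).trans _ _ _ (EqvGen.rel _ _ (Or.inl rfl))), he' x, he x⟩
  have h2 : Even (K.erase a).card := even_card_of_involution (f := f) fun x hx => by
    obtain ⟨hxa, hxK⟩ := Finset.mem_erase.1 hx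
    have hxK' := (hmem x).1 hxK
    have hxb : x ≠ f a := by rintro rfl; exact hb hxK'
    have hxc : x ≠ c := by rintro rfl; exact hac (hle _ _ hxK')
    have hxd : x ≠ f c := by rintro rfl; exact hfc (hle _ _ hxK')
    refine ⟨Finset.mem_erase.2 ⟨fun h => hxb (by rw [← h, hf x]), (hmem _).2 ?_⟩, hf' x, hf x⟩
    exact hxK'.trans _ _ _ (EqvGen.rel _ _ (Or.inr ⟨rfl, hxa, hxb, hxc, hxd⟩))
  have h3 := Finset.card_erase_add_one ((hmem a).2 (EqvGen.refl a))
  rw [← h3, Nat.even_add_one] at h1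
  exact h1 h2

/-- An `f` maximising the number of connected pairs works. If `a` and `c` in one part were
disconnected, recombining their `f`-edges within the part would merge their components and
disconnect nothing. -/
theorem exists_connecting_involution {β : Type*} (part : V → β) {e : V → V}
    (he : Function.Involutive e) (he' : ∀ x, e x ≠ x)
    (hex : ∃ f : V → V, Function.Involutive f ∧ (∀ x, f x ≠ x) ∧ ∀ x, part (f x) = part x) :
    ∃ f : V → V, Function.Involutive f ∧ (∀ x, f x ≠ x) ∧ (∀ x, part (f x) = part x) ∧
      ∀ x y, part x = part y → EqvGen (MatchRel e f) x y := by
  classical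
  let N : (V → V) → Finset (V × V) := fun f =>
    Finset.univ.filter fun p => EqvGen (MatchRel e f) p.1 p.2
  obtain ⟨f, hf, hmax⟩ := Finset.exists_max_image
    (Finset.univ.filter fun f : V → V =>
      Function.Involutive f ∧ (∀ x, f x ≠ x) ∧ ∀ x, part (f x) = part x)
    (fun f => (N f).card) (by
      obtain ⟨f, hf⟩ := hex
      exact ⟨f, by simpa using hf⟩)
  simp only [Finset.mem_filter, Finset.mem_univ, true_and] at hf hmax
  obtain ⟨hf, hf', hfp⟩ := hf
  refine ⟨f, hf, hf', hfp, fun a c hpac => ?_⟩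
  by_contra hac
  have hcut := eqvGen_cut he hf he' hf' hac
  have hrelf : ∀ x, EqvGen (MatchRel e f) x (f x) := fun x => EqvGen.rel _ _ (Or.inr rfl)
  have nac : a ≠ c := by rintro rfl; exact hac (EqvGen.refl _)
  have nad : a ≠ f c := fun h => hac (h ▸ (hrelf c).symm _ _)
  have nbc : f a ≠ c := fun h => hac (h ▸ hrelf a)
  have nbd : f a ≠ f c := fun h => nac (hf.injective h)
  -- The edges `{a, f a}` and `{c, f c}` are replaced by `{a, c}` and `{f a, f c}`.
  let f₁ : V → V := fun v => if v = a then c else if v = c then a else if v = f a then f c else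
    if v = f c then f a else f v
  have ha : f₁ a = c := if_pos rfl
  have hc : f₁ c = a := by simp [f₁, nac.symm]
  have hb : f₁ (f a) = f c := by simp [f₁, hf' a, nbc]
  have hd : f₁ (f c) = f a := by simp [f₁, hf' c, nad.symm, nbd.symm]
  have ho : ∀ v, v ≠ a → v ≠ f a → v ≠ c → v ≠ f c → f₁ v = f v := fun v h1 h2 h3 h4 => by
    simp [f₁, h1, h2, h3, h4]
  have hcases : ∀ (P : V → Prop), P a → P (f a) → P c → P (f c) →
      (∀ v, v ≠ a → v ≠ f a → v ≠ c → v ≠ f c → P v) → ∀ v, P v := by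
    intro P h1 h2 h3 h4 h5 v
    by_cases e1 : v = a
    · exact e1 ▸ h1
    by_cases e2 : v = f a
    · exact e2 ▸ h2
    by_cases e3 : v = c
    · exact e3 ▸ h3
    by_cases e4 : v = f c
    · exact e4 ▸ h4
    exact h5 v e1 e2 e3 e4
  have inv₁ : Function.Involutive f₁ := by
    refine hcases _ (by rw [ha, hc]) (by rw [hb, hd]) (by rw [hc, ha]) (by rw [hd, hb]) ?_
    intro v h1 h2 h3 h4
    rw [ho v h1 h2 h3 h4, ho, hf v]
    · exact fun h => h2 (by rw [← h, hf v])
    · exact fun h => h1 (hf.injective h)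
    · exact fun h => h4 (by rw [← h, hf v])
    · exact fun h => h3 (hf.injective h)
  have fpf₁ : ∀ x, f₁ x ≠ x := by
    refine hcases _ (by rw [ha]; exact nac.symm) (by rw [hb]; exact nbd.symm)
      (by rw [hc]; exact nac) (by rw [hd]; exact nbd) ?_
    intro v h1 h2 h3 h4
    rw [ho v h1 h2 h3 h4]
    exact hf' v
  have part₁ : ∀ x, part (f₁ x) = part x := by
    refine hcases _ (by rw [ha, hpac]) (by rw [hb, hfp, hfp, hpac]) (by rw [hc, hpac])
      (by rw [hd, hfp, hfp, hpac]) ?_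
    intro v h1 h2 h3 h4
    rw [ho v h1 h2 h3 h4, hfp]
  have hrel₁ : ∀ x, EqvGen (MatchRel e f₁) x (f₁ x) := fun x => EqvGen.rel _ _ (Or.inr rfl)
  have hac₁ : EqvGen (MatchRel e f₁) a c := ha ▸ hrel₁ a
  -- The connection found by `eqvGen_cut` avoids the two removed edges, so it survives in `f₁`.
  have hab₁ : EqvGen (MatchRel e f₁) a (f a) := by
    refine EqvGen.mono (fun x y h => ?_) _ _ hcut
    rcases h with h | ⟨h, h1, h2, h3, h4⟩
    · exact Or.inl h
    · exact Or.inr (by rw [h, ho x h1 h2 h3 h4])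
  have hbd₁ : EqvGen (MatchRel e f₁) (f a) (f c) := hb ▸ hrel₁ (f a)
  have hcd₁ : EqvGen (MatchRel e f₁) c (f c) :=
    (hac₁.symm _ _).trans _ _ _ (hab₁.trans _ _ _ hbd₁)
  have hff₁ : ∀ x, EqvGen (MatchRel e f₁) x (f x) := by
    refine hcases _ hab₁ (by rw [hf a]; exact hab₁.symm _ _) hcd₁
      (by rw [hf c]; exact hcd₁.symm _ _) ?_
    intro v h1 h2 h3 h4
    rw [← ho v h1 h2 h3 h4]
    exact hrel₁ v
  have hle : ∀ x y, EqvGen (MatchRel e f) x y → EqvGen (MatchRel e f₁) x y := by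
    intro x y h
    induction h with
    | rel x y h =>
      rcases h with rfl | rfl
      · exact EqvGen.rel _ _ (Or.inl rfl)
      · exact hff₁ x
    | refl x => exact EqvGen.refl x
    | symm x y _ ih => exact ih.symm _ _
    | trans x y z _ _ ih ih' => exact ih.trans _ _ _ ih'
  refine absurd (hmax f₁ ⟨inv₁, fpf₁, part₁⟩) (not_le.2 (Finset.card_lt_card ?_))
  refine Finset.ssubset_iff_subset_ne.2 ⟨fun p hp => ?_, fun h => hac ?_⟩
  · simp only [N, Finset.mem_filter, Finset.mem_univ, true_and] at hp ⊢
    exact hle _ _ hp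
  · have : (a, c) ∈ N f := by
      rw [h]
      simpa [N] using hac₁
    simpa [N] using this

end Matchings

/-! ### Brickwork loops and the bound for clusters -/

section Loops

variable {V : Type*} [Fintype V] [DecidableEq V] {q t : ℕ}

/-- The vectors invariant under the gates on the pairs `{x, e x}` for `x ∈ S`. -/
def pairSub (q t : ℕ) (e : V → V) (S : Finset V) : Submodule ℂ (FoldedSpace q t V) :=
  ⨅ x ∈ S, invSub q t {x, e x}

theorem mem_pairSub {e : V → V} {S : Finset V} {v : FoldedSpace q t V} :
    v ∈ pairSub q t e S ↔ ∀ x ∈ S, v ∈ invSub q t {x, e x} := by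
  simp [pairSub, Submodule.mem_iInf]

theorem pairSub_union (e : V → V) (S T : Finset V) :
    pairSub q t e (S ∪ T) = pairSub q t e S ⊓ pairSub q t e T := by
  ext v
  simp only [Submodule.mem_inf, mem_pairSub, Finset.mem_union, or_imp, forall_and]

theorem commute_proj_pairSub {e e' : V → V} {S T : Finset V} (hST : Disjoint S T)
    (hS : ∀ x ∈ S, e x ∈ S) (hT : ∀ x ∈ T, e' x ∈ T) :
    Commute (proj (pairSub q t e S)) (proj (pairSub q t e' T)) := by
  refine commute_proj_iInf fun y => commute_proj_iInf fun hy => ?_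
  refine (commute_proj_iInf fun x => commute_proj_iInf fun hx => ?_).symm
  refine commute_proj_invSub (Finset.disjoint_of_subset_left (u := T) ?_
    (Finset.disjoint_of_subset_right (u := S) ?_ hST.symm))
  · simp [Finset.insert_subset_iff, hy, hT y hy]
  · simp [Finset.insert_subset_iff, hx, hS x hx]

theorem sitePair_odd_disjoint {m j j' : ℕ} (hm : Even m) (hj : j ∈ Finset.Icc 1 (m / 2))
    (hj' : j' ∈ Finset.Icc 1 (m / 2)) (h : j ≠ j') :
    Disjoint (sitePair m (2 * j - 1) (2 * j)) (sitePair m (2 * j' - 1) (2 * j')) := by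
  obtain ⟨l, rfl⟩ := hm
  rw [Finset.mem_Icc] at hj hj'
  have hmod : ∀ j, 1 ≤ j ∧ j ≤ (l + l) / 2 → (2 * j - 1) % (l + l) = 2 * j - 1 ∧
      (2 * j) % (l + l) = if j = l then 0 else 2 * j := by
    intro j hj
    refine ⟨Nat.mod_eq_of_lt (by omega), ?_⟩
    split_ifs with h
    · rw [h, two_mul, Nat.mod_self]
    · exact Nat.mod_eq_of_lt (by omega)
  rw [Finset.disjoint_left]
  intro i hi hi'
  simp only [sitePair, Finset.mem_filter, Finset.mem_univ, true_and, (hmod j hj).1, (hmod j hj).2,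
    (hmod j' hj').1, (hmod j' hj').2] at hi hi'
  split_ifs at hi hi' <;> omega

theorem sitePair_even_disjoint {m j j' : ℕ} (hm : Even m) (hj : j ∈ Finset.Icc 1 (m / 2))
    (hj' : j' ∈ Finset.Icc 1 (m / 2)) (h : j ≠ j') :
    Disjoint (sitePair m (2 * j) (2 * j + 1)) (sitePair m (2 * j') (2 * j' + 1)) := by
  obtain ⟨l, rfl⟩ := hm
  rw [Finset.mem_Icc] at hj hj'
  have hmod : ∀ j, 1 ≤ j ∧ j ≤ (l + l) / 2 → (2 * j) % (l + l) = (if j = l then 0 else 2 * j) ∧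
      (2 * j + 1) % (l + l) = if j = l then 1 else 2 * j + 1 := by
    intro j hj
    split_ifs with h
    · subst h
      rw [← two_mul, Nat.mod_self, Nat.add_mod_left]
      exact ⟨rfl, Nat.mod_eq_of_lt (by omega)⟩
    · exact ⟨Nat.mod_eq_of_lt (by omega), Nat.mod_eq_of_lt (by omega)⟩
  rw [Finset.disjoint_left]
  intro i hi hi'
  simp only [sitePair, Finset.mem_filter, Finset.mem_univ, true_and, (hmod j hj).1, (hmod j hj).2,
    (hmod j' hj').1, (hmod j' hj').2] at hi hi'
  split_ifs at hi hi' <;> omega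

theorem brickworkOp_eq_proj_mul {m : ℕ} (hm : Even m) : brickworkOp q t m =
    proj (⨅ j ∈ Finset.Icc 1 (m / 2), invSub q t (sitePair m (2 * j - 1) (2 * j))) *
      proj (⨅ j ∈ Finset.Icc 1 (m / 2), invSub q t (sitePair m (2 * j) (2 * j + 1))) := by
  rw [brickworkOp, layerOp_eq_proj, layerOp_eq_proj, Finset.iInf_finset_image,
    Finset.iInf_finset_image]
  · simp only [Finset.mem_image]
    rintro _ ⟨j, hj, rfl⟩ _ ⟨j', hj', rfl⟩ h
    exact sitePair_even_disjoint hm hj hj' fun h' => h (h' ▸ rfl)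
  · simp only [Finset.mem_image]
    rintro _ ⟨j, hj, rfl⟩ _ ⟨j', hj', rfl⟩ h
    exact sitePair_odd_disjoint hm hj hj' fun h' => h (h' ▸ rfl)

omit [Fintype V] in
theorem map_sitePair {m : ℕ} (hm : 0 < m) (φ : Fin m ↪ V) {x : ℕ → V} (hφ : ∀ i, φ i = x i)
    (hx : ∀ i, x (i + m) = x i) (a b : ℕ) : (sitePair m a b).map φ = {x a, x b} := by
  have hmod : ∀ a, x (a % m) = x a := (Function.Periodic.map_mod_nat (f := x) hx)
  ext v
  simp only [sitePair, Finset.mem_map, Finset.mem_filter, Finset.mem_univ, true_and, hφ,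
    Finset.mem_insert, Finset.mem_singleton]
  constructor
  · rintro ⟨i, hi | hi, rfl⟩
    · left; rw [hi, hmod]
    · right; rw [hi, hmod]
  · rintro (rfl | rfl)
    · exact ⟨⟨a % m, Nat.mod_lt _ hm⟩, Or.inl rfl, hmod a⟩
    · exact ⟨⟨b % m, Nat.mod_lt _ hm⟩, Or.inr rfl, hmod b⟩

/-- The two matchings of an alternating cycle act as a brickwork loop. -/
theorem friedrichsBound_cycle {e f : V → V} (he : Function.Involutive e)
    (hf : Function.Involutive f) {l : ℕ} (hl : 0 < l) {x : ℕ → V}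
    (hx : ∀ i, x (i + 2 * l) = x i) (hfx : ∀ j, f (x (2 * j)) = x (2 * j + 1))
    (hex : ∀ j, e (x (2 * j + 1)) = x (2 * j + 2)) (φ : Fin (2 * l) ↪ V) (hφ : ∀ i, φ i = x i) :
    FriedrichsBound (pairSub q t e (Finset.univ.map φ)) (pairSub q t f (Finset.univ.map φ))
      (brickworkSSV q t (2 * l)) := by
  have hm : Even (2 * l) := even_two_mul l
  have hm0 : 0 < 2 * l := by omega
  have hs : 2 * l / 2 = l := by omega
  have h := friedrichsBound_subleadingSV
    (⨅ j ∈ Finset.Icc 1 (2 * l / 2), invSub q t (sitePair (2 * l) (2 * j - 1) (2 * j)))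
    (⨅ j ∈ Finset.Icc 1 (2 * l / 2), invSub q t (sitePair (2 * l) (2 * j) (2 * j + 1)))
  rw [← brickworkOp_eq_proj_mul hm] at h
  have hmemA : ∀ n, x n ∈ Finset.univ.map φ := by
    intro n
    rw [← Function.Periodic.map_mod_nat (f := x) hx n, ← hφ ⟨n % (2 * l), Nat.mod_lt _ hm0⟩]
    exact Finset.mem_map_of_mem _ (Finset.mem_univ _)
  -- The pairs `{2j-1, 2j}` with `1 ≤ j ≤ l` cover the indices `1, …, 2l`, and the pairs `{2j,
  -- 2j+1}` cover `2, …, 2l+1`; each layer needs representatives in its own window.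
  have hsurj : ∀ y ∈ Finset.univ.map φ, ∃ n, 1 ≤ n ∧ n ≤ 2 * l ∧ y = x n := by
    intro y hy
    obtain ⟨i, -, rfl⟩ := Finset.mem_map.1 hy
    rcases Nat.eq_zero_or_pos i.val with h0 | h0
    · exact ⟨2 * l, by omega, le_rfl, by rw [hφ, h0, ← hx, zero_add]⟩
    · exact ⟨i, h0, i.2.le, hφ i⟩
  have hsurj' : ∀ y ∈ Finset.univ.map φ, ∃ n, 2 ≤ n ∧ n ≤ 2 * l + 1 ∧ y = x n := by
    intro y hy
    obtain ⟨n, h1, h2, rfl⟩ := hsurj y hy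
    rcases Nat.lt_or_ge n 2 with h3 | h3
    · exact ⟨n + 2 * l, by omega, by omega, (hx n).symm⟩
    · exact ⟨n, h3, by omega, rfl⟩
  refine FriedrichsBound.of_slices (S := slice φ) (inner_eq_sum_slice φ) (exists_slice_eq φ)
    (fun v => ?_) (fun v => ?_) (subleadingSV_nonneg _) h
  · simp only [mem_pairSub, Submodule.mem_iInf, hs]
    trans ∀ j ∈ Finset.Icc 1 l, v ∈ invSub q t {x (2 * j - 1), x (2 * j)}
    · constructor
      · intro hv j hj
        obtain ⟨k, rfl⟩ : ∃ k, j = k + 1 := ⟨j - 1, by have := Finset.mem_Icc.1 hj; omega⟩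
        have := hv _ (hmemA (2 * k + 1))
        rwa [hex] at this
      · intro hv y hy
        obtain ⟨n, h1, h2, rfl⟩ := hsurj y hy
        rcases Nat.even_or_odd' n with ⟨k, rfl | rfl⟩
        · obtain ⟨k, rfl⟩ : ∃ j, k = j + 1 := ⟨k - 1, by omega⟩
          have h3 := hv (k + 1) (Finset.mem_Icc.2 ⟨by omega, by omega⟩)
          have h4 : e (x (2 * (k + 1))) = x (2 * (k + 1) - 1) := by
            rw [show 2 * (k + 1) = 2 * k + 2 by ring, ← hex, he]
            rfl
          rwa [h4, Finset.pair_comm]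
        · have h3 := hv (k + 1) (Finset.mem_Icc.2 ⟨by omega, by omega⟩)
          rw [hex]
          exact h3
    · simp only [← map_sitePair hm0 φ hφ hx, mem_invSub_map_iff]
      exact ⟨fun h z j hj => h j hj z, fun h j hj z => h z j hj⟩
  · simp only [mem_pairSub, Submodule.mem_iInf, hs]
    trans ∀ j ∈ Finset.Icc 1 l, v ∈ invSub q t {x (2 * j), x (2 * j + 1)}
    · constructor
      · intro hv j hj
        have := hv _ (hmemA (2 * j))
        rwa [hfx] at this
      · intro hv y hy
        obtain ⟨n, h1, h2, rfl⟩ := hsurj' y hy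
        rcases Nat.even_or_odd' n with ⟨k, rfl | rfl⟩
        · have h3 := hv k (Finset.mem_Icc.2 ⟨by omega, by omega⟩)
          rwa [hfx]
        · have h3 := hv k (Finset.mem_Icc.2 ⟨by omega, by omega⟩)
          have h4 : f (x (2 * k + 1)) = x (2 * k) := by rw [← hfx, hf]
          rwa [h4, Finset.pair_comm]
    · simp only [← map_sitePair hm0 φ hφ hx, mem_invSub_map_iff]
      exact ⟨fun h z j hj => h j hj z, fun h j hj z => h z j hj⟩

theorem maxBrickworkSSV_nonneg (n : ℕ) : 0 ≤ maxBrickworkSSV q t n := by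
  refine Real.sSup_nonneg ?_
  rintro _ ⟨m, -, rfl⟩
  exact subleadingSV_nonneg _

theorem brickworkSSV_le_max {m n : ℕ} (hm : Even m) (h2 : 2 ≤ m) (hn : m ≤ n) :
    brickworkSSV q t m ≤ maxBrickworkSSV q t n :=
  le_csSup (((Set.finite_Iic n).subset fun _ h => h.2.2).image _).bddAbove ⟨m, ⟨hm, h2, hn⟩, rfl⟩

theorem FriedrichsBound.mono {E : Type*} [NormedAddCommGroup E] [InnerProductSpace ℂ E]
    [FiniteDimensional ℂ E] {K L : Submodule ℂ E} {s s' : ℝ} (h : FriedrichsBound K L s)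
    (hs : s ≤ s') : FriedrichsBound K L s' :=
  fun v => (h v).trans (mul_le_mul_of_nonneg_right hs (norm_nonneg v))

/-- One alternating cycle is split off as a brickwork loop, whose length is at most the number of
sites. It is disjoint from the remaining sites, so `FriedrichsBound.inf` combines it with the
induction hypothesis. -/
theorem friedrichsBound_pairSub {e f : V → V} (he : Function.Involutive e)
    (hf : Function.Involutive f) (he' : ∀ x, e x ≠ x) (hf' : ∀ x, f x ≠ x) (S : Finset V)
    (heS : ∀ x ∈ S, e x ∈ S) (hfS : ∀ x ∈ S, f x ∈ S) :
    FriedrichsBound (pairSub q t e S) (pairSub q t f S) (maxBrickworkSSV q t (Fintype.card V)) := by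
  induction S using Finset.strongInduction with
  | H S ih =>
    rcases S.eq_empty_or_nonempty with rfl | ⟨x₀, hx₀⟩
    · simpa [pairSub] using FriedrichsBound.top (maxBrickworkSSV_nonneg _)
    obtain ⟨l, x, hl, hx0, hper, hfx, hex, hinj⟩ := exists_alternating_cycle he hf he' hf' x₀
    let φ : Fin (2 * l) ↪ V :=
      ⟨fun i => x i, fun i j hij => Fin.ext (hinj (Set.mem_Iio.2 i.2) (Set.mem_Iio.2 j.2) hij)⟩
    have hcyc := friedrichsBound_cycle (q := q) (t := t) he hf hl hper hfx hex φ fun _ => rfl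
    set A := Finset.univ.map φ with hA
    have hm0 : 0 < 2 * l := by omega
    have hmemA : ∀ n, x n ∈ A := by
      intro n
      rw [← Function.Periodic.map_mod_nat (f := x) hper n]
      exact Finset.mem_map_of_mem φ (Finset.mem_univ ⟨n % (2 * l), Nat.mod_lt _ hm0⟩)
    have hex' : ∀ k, e (x (2 * k)) ∈ A := by
      intro k
      -- The predecessor of index `2k` is reached after adding a full period, which also covers `k =
      -- 0`.
      rw [← hper, show 2 * k + 2 * l = 2 * (k + l - 1) + 2 by omega, ← hex, he]
      exact hmemA _
    have heA : ∀ y ∈ A, e y ∈ A := by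
      intro y hy
      obtain ⟨i, -, rfl⟩ := Finset.mem_map.1 hy
      change e (x i) ∈ A
      rcases Nat.even_or_odd' i.val with ⟨k, hk | hk⟩
      · rw [hk]; exact hex' k
      · rw [hk, hex]; exact hmemA _
    have hfA : ∀ y ∈ A, f y ∈ A := by
      intro y hy
      obtain ⟨i, -, rfl⟩ := Finset.mem_map.1 hy
      change f (x i) ∈ A
      rcases Nat.even_or_odd' i.val with ⟨k, hk | hk⟩
      · rw [hk, hfx]; exact hmemA _
      · rw [hk, ← hfx, hf]; exact hmemA _
    have hxS : ∀ n, x n ∈ S := by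
      intro n
      induction n with
      | zero => exact hx0 ▸ hx₀
      | succ n ihn =>
        rcases Nat.even_or_odd' n with ⟨k, rfl | rfl⟩
        · rw [← hfx]; exact hfS _ ihn
        · rw [show 2 * k + 1 + 1 = 2 * k + 2 by rfl, ← hex]; exact heS _ ihn
    have hAS : A ⊆ S := by
      intro y hy
      obtain ⟨i, -, rfl⟩ := Finset.mem_map.1 hy
      exact hxS i
    have hcard : 2 * l ≤ Fintype.card V := by
      simpa using Fintype.card_le_of_embedding φ
    have hsub : S \ A ⊂ S := Finset.sdiff_ssubset hAS ⟨x 0, hmemA 0⟩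
    have heB : ∀ y ∈ S \ A, e y ∈ S \ A := by
      intro y hy
      rw [Finset.mem_sdiff] at hy ⊢
      exact ⟨heS y hy.1, fun h => hy.2 (he y ▸ heA _ h)⟩
    have hfB : ∀ y ∈ S \ A, f y ∈ S \ A := by
      intro y hy
      rw [Finset.mem_sdiff] at hy ⊢
      exact ⟨hfS y hy.1, fun h => hy.2 (hf y ▸ hfA _ h)⟩
    have hd : Disjoint A (S \ A) := Finset.disjoint_sdiff
    have := FriedrichsBound.inf (maxBrickworkSSV_nonneg _)
      (hcyc.mono (brickworkSSV_le_max (even_two_mul l) (by omega) hcard)) (ih _ hsub heB hfB)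
      (commute_proj_pairSub hd heA heB) (commute_proj_pairSub hd heA hfB)
      (commute_proj_pairSub hd hfA heB) (commute_proj_pairSub hd hfA hfB)
    rwa [← pairSub_union, ← pairSub_union, Finset.union_sdiff_of_subset hAS] at this

/-- The bound for a perfect matching followed by a partition into clusters of even size. -/
theorem friedrichsBound_clusters {e : V → V} (he : Function.Involutive e) (he' : ∀ x, e x ≠ x)
    (P : Finpartition (Finset.univ : Finset V)) (hP : ∀ C ∈ P.parts, Even C.card) :
    FriedrichsBound (pairSub q t e Finset.univ) (⨅ C ∈ P.parts, invSub q t C)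
      (maxBrickworkSSV q t (Fintype.card V)) := by
  have hpart : ∀ x, P.part x ∈ P.parts := fun x => P.part_mem.2 (Finset.mem_univ x)
  have hself : ∀ x, x ∈ P.part x := fun x => P.mem_part (Finset.mem_univ x)
  have hex : ∃ f : V → V, Function.Involutive f ∧ (∀ x, f x ≠ x) ∧ ∀ x, P.part (f x) = P.part x := by
    have h2 : ∀ C : Finset V, ∃ f : V → V, C ∈ P.parts →
        ∀ y ∈ C, f y ∈ C ∧ f y ≠ y ∧ f (f y) = y := by
      intro C
      by_cases hC : C ∈ P.parts
      · obtain ⟨f, hf⟩ := exists_involution_of_even (hP C hC)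
        exact ⟨f, fun _ => hf⟩
      · exact ⟨id, fun h => absurd h hC⟩
    choose F hF using h2
    have h3 : ∀ x, P.part (F (P.part x) x) = P.part x := fun x =>
      P.part_eq_of_mem (hpart x) (hF _ (hpart x) x (hself x)).1
    refine ⟨fun x => F (P.part x) x, fun x => ?_, fun x => (hF _ (hpart x) x (hself x)).2.1, h3⟩
    change F (P.part (F (P.part x) x)) (F (P.part x) x) = x
    rw [h3]
    exact (hF _ (hpart x) x (hself x)).2.2
  obtain ⟨f, hf, hf', hfp, hconn⟩ := exists_connecting_involution P.part he he' hex
  -- Pairs of `f` lie inside clusters, so cluster invariance implies pair invariance; conversely `e`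
  -- and `f` connect each cluster, so universality recovers cluster invariance.
  refine FriedrichsBound.mono_right (maxBrickworkSSV_nonneg _)
    (friedrichsBound_pairSub he hf he' hf' Finset.univ (by simp) (by simp)) ?_ ?_
  · intro v hv
    simp only [Submodule.mem_iInf] at hv
    rw [mem_pairSub]
    intro x _
    refine invSub_anti ?_ (hv _ (hpart x))
    have : f x ∈ P.part x := hfp x ▸ hself (f x)
    simp [Finset.insert_subset_iff, hself x, this]
  · rintro v ⟨hve, hvf⟩
    simp only [SetLike.mem_coe, mem_pairSub] at hve hvf
    simp only [Submodule.mem_iInf]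
    intro C hC
    refine mem_invSub_of_connected (r := MatchRel e f) ?_ (fun x => ⟨e x, Or.inl rfl⟩) ?_
      (P.nonempty_of_mem_parts hC)
    · rintro x y (rfl | rfl)
      · exact ⟨{x, e x}, by simp, by simp, hve x (Finset.mem_univ x)⟩
      · exact ⟨{x, f x}, by simp, by simp, hvf x (Finset.mem_univ x)⟩
    · intro x hx y hy
      exact hconn x y (by rw [P.part_eq_of_mem hC hx, P.part_eq_of_mem hC hy])

end Loops

/-! ### Cluster-merging graphs and sequences of layers -/

section Circuits

variable {V : Type*} [Fintype V] [DecidableEq V] {q t : ℕ}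

omit [Fintype V] in
/-- A family of disjoint pairs is given by an involution of the sites that it covers. -/
theorem exists_partner {S : Finset (Finset V)} (hcard : ∀ s ∈ S, s.card = 2)
    (hdisj : ∀ s ∈ S, ∀ s' ∈ S, s ≠ s' → Disjoint s s') :
    ∃ e : V → V, ∀ s ∈ S, ∀ x ∈ s, s = {x, e x} ∧ e x ∈ s ∧ e x ≠ x ∧ e (e x) = x := by
  have h : ∀ x, ∃ y, ∀ s ∈ S, x ∈ s → y ≠ x ∧ s = {x, y} := by
    intro x
    by_cases hx : ∃ s ∈ S, x ∈ s
    · obtain ⟨s, hs, hxs⟩ := hx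
      obtain ⟨a, b, hab, rfl⟩ := Finset.card_eq_two.1 (hcard s hs)
      have huniq : ∀ s' ∈ S, x ∈ s' → s' = {a, b} := fun s' hs' hxs' => by
        by_contra hne
        exact Finset.disjoint_left.1 (hdisj _ hs' _ hs hne) hxs' hxs
      rcases (by simpa using hxs : x = a ∨ x = b) with rfl | rfl
      · exact ⟨b, fun s' hs' hxs' => ⟨hab.symm, huniq s' hs' hxs'⟩⟩
      · exact ⟨a, fun s' hs' hxs' => ⟨hab, by rw [huniq s' hs' hxs', Finset.pair_comm]⟩⟩
    · exact ⟨x, fun s hs hxs => absurd ⟨s, hs, hxs⟩ hx⟩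
  choose e he using h
  refine ⟨e, fun s hs x hx => ?_⟩
  obtain ⟨h1, h2⟩ := he x s hs hx
  have h3 : e x ∈ s := by rw [h2]; simp
  obtain ⟨h4, h5⟩ := he (e x) s hs h3
  refine ⟨h2, h3, h1, ?_⟩
  have h6 : e (e x) ∈ s := by rw [h5]; simp
  rw [h2] at h6
  simp only [Finset.mem_insert, Finset.mem_singleton] at h6
  exact h6.resolve_right h4

theorem iInf_invSub_eq_pairSub {S : Finset (Finset V)} {e : V → V} (hne : ∀ s ∈ S, s.Nonempty)
    (he : ∀ s ∈ S, ∀ x ∈ s, s = {x, e x}) :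
    ⨅ s ∈ S, invSub q t s = pairSub q t e (S.biUnion id) := by
  ext v
  simp only [Submodule.mem_iInf, mem_pairSub, Finset.mem_biUnion, id]
  constructor
  · rintro h x ⟨s, hs, hx⟩
    rw [← he s hs x hx]
    exact h s hs
  · intro h s hs
    obtain ⟨x, hx⟩ := hne s hs
    rw [he s hs x hx]
    exact h x ⟨s, hs, hx⟩

theorem Finpartition.parts_disjoint (P : Finpartition (Finset.univ : Finset V)) :
    ∀ C ∈ P.parts, ∀ C' ∈ P.parts, C ≠ C' → Disjoint C C' :=
  fun _ hC _ hC' h => P.disjoint hC hC' h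

/-- An edge meeting `C` has exactly one site there, because it joins distinct clusters, and distinct
edges are disjoint. -/
theorem ClusterMergingGraph.card_inter_covered (G : ClusterMergingGraph V) {C : Finset V}
    (hC : C ∈ G.nodes.parts) : (C ∩ G.edges.biUnion id).card = G.degree C := by
  have h1 : C ∩ G.edges.biUnion id = (G.edges.filter fun e => ¬ Disjoint e C).biUnion (C ∩ ·) := by
    ext v
    simp only [Finset.mem_inter, Finset.mem_biUnion, Finset.mem_filter, id]
    constructor
    · rintro ⟨hv, e, he, hve⟩
      exact ⟨e, ⟨he, fun h => Finset.disjoint_left.1 h hve hv⟩, hv, hve⟩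
    · rintro ⟨e, ⟨he, -⟩, hv, hve⟩
      exact ⟨hv, e, he, hve⟩
  rw [h1, Finset.card_biUnion, ClusterMergingGraph.degree, Finset.card_eq_sum_ones]
  · refine Finset.sum_congr rfl fun e he => ?_
    obtain ⟨he, hd⟩ := Finset.mem_filter.1 he
    have hlt : (C ∩ e).card < e.card := Finset.card_lt_card
      (Finset.ssubset_iff_subset_ne.2 ⟨Finset.inter_subset_right, fun h =>
        G.joins_distinct e he C hC (Finset.inter_eq_right.1 h)⟩)
    have hpos : 0 < (C ∩ e).card := by
      rw [Finset.card_pos, ← Finset.not_disjoint_iff_nonempty_inter, disjoint_comm]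
      exact hd
    rw [G.card_edge e he] at hlt
    omega
  · intro e he e' he' hne
    exact Finset.disjoint_of_subset_left Finset.inter_subset_right
      (Finset.disjoint_of_subset_right Finset.inter_subset_right
        (G.disjoint_edges e (Finset.mem_filter.1 he).1 e' (Finset.mem_filter.1 he').1 hne))

/-- The sites of a cluster not covered by an edge number weight minus degree, which is even. Pairing
them inside the cluster completes the edges to a perfect matching. -/
theorem ClusterMergingGraph.ssv_le (G : ClusterMergingGraph V)
    (hG : ∀ C ∈ G.nodes.parts, Even C.card ∧ Even (G.degree C)) :
    G.ssv q t ≤ maxBrickworkSSV q t (Fintype.card V) := by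
  set P := G.nodes with hPdef
  have hpart : ∀ x, P.part x ∈ P.parts := fun x => P.part_mem.2 (Finset.mem_univ x)
  have hself : ∀ x, x ∈ P.part x := fun x => P.mem_part (Finset.mem_univ x)
  set D := G.edges.biUnion id with hD
  have hmemD : ∀ x, x ∈ D ↔ ∃ s ∈ G.edges, x ∈ s := fun x => by simp [hD]
  obtain ⟨e₀, he₀⟩ := exists_partner G.card_edge G.disjoint_edges
  have h2 : ∀ C : Finset V, ∃ f : V → V, C ∈ P.parts →
      ∀ y ∈ C \ D, f y ∈ C \ D ∧ f y ≠ y ∧ f (f y) = y := by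
    intro C
    by_cases hC : C ∈ P.parts
    · have heven : Even (C \ D).card := by
        have h1 := Finset.card_sdiff_add_card_inter C D
        rw [G.card_inter_covered hC] at h1
        have := (hG C hC).1
        rw [← h1, Nat.even_add] at this
        exact this.2 (hG C hC).2
      obtain ⟨f, hf⟩ := exists_involution_of_even heven
      exact ⟨f, fun _ => hf⟩
    · exact ⟨id, fun h => absurd h hC⟩
  choose F hF using h2
  let e : V → V := fun x => if x ∈ D then e₀ x else F (P.part x) x
  have heD : ∀ x ∈ D, e x = e₀ x := fun x hx => if_pos hx
  have heC : ∀ x, x ∉ D → e x = F (P.part x) x := fun x hx => if_neg hx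
  have hmemC : ∀ x, x ∉ D → e x ∈ P.part x \ D := fun x hx => by
    rw [heC x hx]
    exact (hF _ (hpart x) x (Finset.mem_sdiff.2 ⟨hself x, hx⟩)).1
  have heD' : ∀ x ∈ D, e x ∈ D := fun x hx => by
    obtain ⟨s, hs, hxs⟩ := (hmemD x).1 hx
    rw [heD x hx]
    exact (hmemD _).2 ⟨s, hs, (he₀ s hs x hxs).2.1⟩
  have he' : ∀ x, e x ≠ x := by
    intro x
    by_cases hx : x ∈ D
    · obtain ⟨s, hs, hxs⟩ := (hmemD x).1 hx
      rw [heD x hx]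
      exact (he₀ s hs x hxs).2.2.1
    · rw [heC x hx]
      exact (hF _ (hpart x) x (Finset.mem_sdiff.2 ⟨hself x, hx⟩)).2.1
  have he : Function.Involutive e := by
    intro x
    by_cases hx : x ∈ D
    · obtain ⟨s, hs, hxs⟩ := (hmemD x).1 hx
      rw [heD _ (heD' x hx), heD x hx]
      exact (he₀ s hs x hxs).2.2.2
    · have h3 := Finset.mem_sdiff.1 (hmemC x hx)
      rw [heC _ h3.2, P.part_eq_of_mem (hpart x) h3.1, heC x hx]
      exact (hF _ (hpart x) x (Finset.mem_sdiff.2 ⟨hself x, hx⟩)).2.2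
  have hop : G.op q t = proj (pairSub q t e Finset.univ) * proj (⨅ C ∈ P.parts, invSub q t C) := by
    -- The added pairs lie inside clusters, so their gates act as the identity after the cluster
    -- projection and may be inserted freely.
    have hle : ⨅ C ∈ P.parts, invSub q t C ≤ pairSub q t e Dᶜ := by
      intro v hv
      simp only [Submodule.mem_iInf] at hv
      rw [mem_pairSub]
      intro x hx
      refine invSub_anti ?_ (hv _ (hpart x))
      have := (Finset.mem_sdiff.1 (hmemC x (Finset.mem_compl.1 hx))).1
      simp [Finset.insert_subset_iff, hself x, this]
    have hcomp : ∀ x ∈ Dᶜ, e x ∈ Dᶜ := fun x hx =>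
      Finset.mem_compl.2 (Finset.mem_sdiff.1 (hmemC x (Finset.mem_compl.1 hx))).2
    rw [ClusterMergingGraph.op, layerOp_eq_proj G.disjoint_edges,
      layerOp_eq_proj P.parts_disjoint, iInf_invSub_eq_pairSub (e := e) ?_ ?_, ← hD,
      show pairSub q t e Finset.univ = pairSub q t e D ⊓ pairSub q t e Dᶜ by
        rw [← pairSub_union, Finset.union_compl],
      proj_inf (commute_proj_pairSub disjoint_compl_right heD' hcomp), mul_assoc]
    · congr 1
      refine LinearMap.ext fun v => ?_
      rw [Module.End.mul_apply, proj_eq_self_iff.2 (hle (proj_mem _ v))]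
    · exact fun s hs => Finset.card_pos.1 (by rw [G.card_edge s hs]; norm_num)
    · intro s hs x hx
      rw [heD x ((hmemD x).2 ⟨s, hs, hx⟩)]
      exact (he₀ s hs x hx).1
  rw [ClusterMergingGraph.ssv, hop]
  exact subleadingSV_le_of_friedrichsBound (maxBrickworkSSV_nonneg _)
    (friedrichsBound_clusters he he' P fun C hC => (hG C hC).1)

theorem CompleteLayer.exists_involution (L : CompleteLayer V) :
    ∃ e : V → V, Function.Involutive e ∧ (∀ x, e x ≠ x) ∧
      ∀ s ∈ L.gates.parts, ∀ x ∈ s, s = {x, e x} := by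
  obtain ⟨e, he⟩ := exists_partner L.card_gate L.gates.parts_disjoint
  have hx := fun x => he _ (L.gates.part_mem.2 (Finset.mem_univ x)) x
    (L.gates.mem_part (Finset.mem_univ x))
  exact ⟨e, fun x => (hx x).2.2.2, fun x => (hx x).2.2.1, fun s hs x hx => (he s hs x hx).1⟩

theorem CompleteLayer.biUnion_gates (L : CompleteLayer V) :
    L.gates.parts.biUnion id = Finset.univ := L.gates.biUnion_parts

theorem norm_layerProduct_le (L : ℕ → CompleteLayer V) (k : ℕ) (v : FoldedSpace q t V) :
    ‖layerProduct q t L k v‖ ≤ ‖v‖ := by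
  induction k with
  | zero => exact le_rfl
  | succ k ih =>
    rw [layerProduct, layerOp_eq_proj (L k).gates.parts_disjoint, Module.End.mul_apply]
    exact (norm_proj_le _ _).trans ih

/-- The unit eigenspace of a product of layers consists of the vectors invariant under all its
gates. -/
theorem eigenspace_layerProduct (L : ℕ → CompleteLayer V) (k : ℕ) :
    Module.End.eigenspace (layerProduct q t L k) 1 =
      ⨅ i < k, ⨅ s ∈ (L i).gates.parts, invSub q t s := by
  ext v
  rw [Module.End.mem_eigenspace_iff, one_smul]
  induction k with
  | zero => simp [layerProduct]
  | succ k ih =>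
    have hK := layerOp_eq_proj (q := q) (t := t) (L k).gates.parts_disjoint
    have hsucc : v ∈ (⨅ i < k + 1, ⨅ s ∈ (L i).gates.parts, invSub q t s) ↔
        v ∈ (⨅ i < k, ⨅ s ∈ (L i).gates.parts, invSub q t s) ∧
          v ∈ ⨅ s ∈ (L k).gates.parts, invSub q t s := by
      simp only [Submodule.mem_iInf, Nat.lt_succ_iff_lt_or_eq, or_imp, forall_and, forall_eq]
    rw [hsucc, ← ih, layerProduct, hK, Module.End.mul_apply]
    constructor
    · intro h
      -- All layers are contractions, so a vector fixed by the product loses no norm under the last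
      -- projection; hence it is fixed by that projection and by the earlier product.
      have h1 : ‖layerProduct q t L k v‖ ≤
          ‖proj (⨅ s ∈ (L k).gates.parts, invSub q t s) (layerProduct q t L k v)‖ := by
        conv_rhs => rw [h]
        exact norm_layerProduct_le L k v
      have h2 := norm_proj_eq_iff.1 (le_antisymm (norm_proj_le _ _) h1)
      rw [proj_eq_self_iff.2 h2] at h
      exact ⟨h, h ▸ h2⟩
    · rintro ⟨h1, h2⟩
      rw [h1, proj_eq_self_iff.2 h2]

/-- The clusters are the connected components of the gates in the first `k` layers. As `1 ≤ k`,
layer `0` matches the sites of each cluster perfectly, so the clusters have even size. -/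
theorem layerRestrictedSSV_le (L : ℕ → CompleteLayer V) {k : ℕ} (hk : 1 ≤ k) :
    layerRestrictedSSV q t L k ≤ maxBrickworkSSV q t (Fintype.card V) := by
  classical
  let r : V → V → Prop := fun x y => ∃ i < k, ∃ s ∈ (L i).gates.parts, x ∈ s ∧ y ∈ s
  let P : Finpartition (Finset.univ : Finset V) := Finpartition.ofSetoid (Relation.EqvGen.setoid r)
  have hmem : ∀ x y, y ∈ P.part x ↔ Relation.EqvGen r x y := fun x y =>
    Finpartition.mem_part_ofSetoid_iff_rel
  have hpart : ∀ x, P.part x ∈ P.parts := fun x => P.part_mem.2 (Finset.mem_univ x)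
  have hrefl : ∀ x, r x x := fun x => ⟨0, hk, _, (L 0).gates.part_mem.2 (Finset.mem_univ x),
    (L 0).gates.mem_part (Finset.mem_univ x), (L 0).gates.mem_part (Finset.mem_univ x)⟩
  have hC : ∀ C ∈ P.parts, ∀ x ∈ C, C = P.part x := fun C hC x hx =>
    (P.part_eq_of_mem hC hx).symm
  have heven : ∀ C ∈ P.parts, Even C.card := by
    obtain ⟨e, he, he', hes⟩ := (L 0).exists_involution
    refine fun C hCP => even_card_of_involution (f := e) fun x hx => ⟨?_, he' x, he x⟩
    rw [hC C hCP x hx, hmem]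
    have h1 := hes _ ((L 0).gates.part_mem.2 (Finset.mem_univ x)) x
      ((L 0).gates.mem_part (Finset.mem_univ x))
    exact Relation.EqvGen.rel _ _ ⟨0, hk, _, (L 0).gates.part_mem.2 (Finset.mem_univ x),
      (L 0).gates.mem_part (Finset.mem_univ x), by rw [h1]; simp⟩
  have hM : ⨅ i < k, ⨅ s ∈ (L i).gates.parts, invSub q t s = ⨅ C ∈ P.parts, invSub q t C := by
    refine le_antisymm ?_ ?_
    · intro v hv
      simp only [Submodule.mem_iInf] at hv ⊢
      intro C hCP
      refine mem_invSub_of_connected (r := r) ?_ (fun x => ⟨x, hrefl x⟩) ?_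
        (P.nonempty_of_mem_parts hCP)
      · rintro x y ⟨i, hi, s, hs, hx, hy⟩
        exact ⟨s, hx, hy, hv i hi s hs⟩
      · intro x hx y hy
        rwa [← hmem, ← hC C hCP x hx]
    · intro v hv
      simp only [Submodule.mem_iInf] at hv ⊢
      intro i hi s hs
      obtain ⟨x, hx⟩ := (L i).gates.nonempty_of_mem_parts hs
      exact invSub_anti (fun y hy => (hmem x y).2 (Relation.EqvGen.rel _ _ ⟨i, hi, s, hs, hx, hy⟩))
        (hv _ (hpart x))
  obtain ⟨e, he, he', hes⟩ := (L k).exists_involution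
  have hop : layerOp q t (L k).gates.parts = proj (pairSub q t e Finset.univ) := by
    rw [layerOp_eq_proj (L k).gates.parts_disjoint, iInf_invSub_eq_pairSub
      (fun s hs => (L k).gates.nonempty_of_mem_parts hs) hes, CompleteLayer.biUnion_gates]
  change subleadingSV (layerOp q t (L k).gates.parts *
    proj (Module.End.eigenspace (layerProduct q t L k) 1)) ≤ _
  rw [hop, eigenspace_layerProduct, hM]
  exact subleadingSV_le_of_friedrichsBound (maxBrickworkSSV_nonneg _)
    (friedrichsBound_clusters he he' P heven)

end Circuits

/-- The first part bounds every cluster-merging graph with nodes of even weight and even degree;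
the second bounds the layer-restricted subleading singular value of each layer above the first in
any sequence of complete layers. -/
theorem mainTheorem6 {V : Type*} [Fintype V] [DecidableEq V] [Nonempty V] (q t : ℕ) :
    (∀ G : ClusterMergingGraph V,
      (∀ C ∈ G.nodes.parts, Even C.card ∧ Even (G.degree C)) →
        G.ssv q t ≤ maxBrickworkSSV q t (Fintype.card V)) ∧
    (∀ L : ℕ → CompleteLayer V, ∀ k : ℕ, 1 ≤ k →
      layerRestrictedSSV q t L k ≤ maxBrickworkSSV q t (Fintype.card V)) :=
  ⟨fun G hG => G.ssv_le hG, fun L _ hk => layerRestrictedSSV_le L hk⟩
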